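/- Let $k$ be a field and let $A$ be a bialgebra over $k$ (associative with unit, coassociative with counit; an antipode is not required). A tetramodule over $A$ is a $k$-vector space $M$ with an $A$-bimodule structure and an $A$-bicomodule structure, with left and right coactions $\Delta_\ell\colon M\to A\otimes_k M$ and $\Delta_r\colon M\to M\otimes_k A$, such that for all $a\in A$, $m\in M$ $$\Delta_\ell(am)=\Delta(a)\,\Delta_\ell(m),\quad \Delta_\ell(ma)=\Delta_\ell(m)\,\Delta(a),\quad \Delta_r(am)=\Delta(a)\,\Delta_r(m),\quad \Delta_r(ma)=\Delta_r(m)\,\Delta(a),$$ where products are taken factor by factor. With linear maps commuting with both actions and both coactions as morphisms, tetramodules form a $k$-linear abelian category $\mathrm{Tetra}(A)$, and $A$ itself is a tetramodule. For tetramodules $M,N$ there are two tetramodule structures on $M\otimes_k N$. In $M\boxtimes_1 N$ the left action is that of $M$, the right action is that of $N$, and the coactions are the diagonal ones, $\Delta_\ell(m\otimes n)=\Delta^1_\ell(m)\Delta^1_\ell(n)\otimes(\Delta^2_\ell(m)\otimes\Delta^2_\ell(n))$ and $\Delta_r(m\otimes n)=(\Delta^1_r(m)\otimes\Delta^1_r(n))\otimes\Delta^2_r(m)\Delta^2_r(n)$.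 In $M\boxtimes_2 N$ the left coaction is that of $M$, the right coaction is that of $N$, and $A$ acts diagonally through $\Delta$ on the left and on the right. Let $\mathrm{Bar}^{\boxtimes_1}_-(A)$ be the complex of tetramodules with $A^{\boxtimes_1(n+2)}$ in homological degree $n\ge 0$ and differential $a_0\otimes\cdots\otimes a_{n+1}\mapsto\sum_{i=0}^{n}(-1)^i a_0\otimes\cdots\otimes a_ia_{i+1}\otimes\cdots\otimes a_{n+1}$ for $n\ge1$, and let $\mathrm{Cobar}^{\boxtimes_2}_+(A)$ be the complex of tetramodules with $A^{\boxtimes_2(n+2)}$ in cohomological degree $n\ge 0$ and differential $a_0\otimes\cdots\otimes a_{n+1}\mapsto\sum_{i=0}^{n+1}(-1)^i a_0\otimes\cdots\otimes\Delta(a_i)\otimes\cdots\otimes a_{n+1}$. The Gerstenhaber–Schack cohomology $H^\bullet_{GS}(A,A)$ is the cohomology of the total complex $\mathrm{Hom}_{\mathrm{Tetra}(A)}(\mathrm{Bar}^{\boxtimes_1}_-(A),\mathrm{Cobar}^{\boxtimes_2}_+(A))$ of $k$-vector spaces. **Theorem (Taillefer).** For every bialgebra $A$ over a field $k$ and every $n\ge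 0$ there is an isomorphism of $k$-vector spaces $$\mathrm{Ext}^n_{\mathrm{Tetra}(A)}(A,A)\;\cong\;H^n\bigl(\mathrm{Hom}_{\mathrm{Tetra}(A)}(\mathrm{Bar}^{\boxtimes_1}_-(A),\mathrm{Cobar}^{\boxtimes_2}_+(A))\bigr)=H^n_{GS}(A,A).$$ -/

import Mathlib

open scoped TensorProduct
open CategoryTheory CategoryTheory.Limits

universe v u

noncomputable section

namespace TensorProduct

section Aux

variable {k : Type*} [CommRing k]
variable {M₁ M₂ M₃ M₄ M₅ M₆ M₇ : Type*}
variable [AddCommGroup M₁] [AddCommGroup M₂] [AddCommGroup M₃] [AddCommGroup M₄]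
variable [AddCommGroup M₅] [AddCommGroup M₆] [AddCommGroup M₇]
variable [Module k M₁] [Module k M₂] [Module k M₃] [Module k M₄]
variable [Module k M₅] [Module k M₆] [Module k M₇]
variable {N₁ N₂ N₃ N₄ N₅ N₆ N₇ : Type*}
variable [AddCommGroup N₁] [AddCommGroup N₂] [AddCommGroup N₃] [AddCommGroup N₄]
variable [AddCommGroup N₅] [AddCommGroup N₆] [AddCommGroup N₇]
variable [Module k N₁] [Module k N₂] [Module k N₃] [Module k N₄]
variable [Module k N₅] [Module k N₆] [Module k N₇]
variable {L₁ L₂ L₃ : Type*}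
variable [AddCommGroup L₁] [AddCommGroup L₂] [AddCommGroup L₃]
variable [Module k L₁] [Module k L₂] [Module k L₃]

lemma map_map₂_tetra
    {p : M₁ →ₗ[k] M₂ →ₗ[k] M₃} {q : N₁ →ₗ[k] N₂ →ₗ[k] N₃}
    {p' : M₄ →ₗ[k] M₅ →ₗ[k] M₆} {q' : N₄ →ₗ[k] N₅ →ₗ[k] N₆}
    {f : M₃ →ₗ[k] M₆} {g : N₃ →ₗ[k] N₆} {f₁ : M₁ →ₗ[k] M₄} {f₂ : M₂ →ₗ[k] M₅}
    {g₁ : N₁ →ₗ[k] N₄} {g₂ : N₂ →ₗ[k] N₅}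
    (hf : ∀ a b, f (p a b) = p' (f₁ a) (f₂ b)) (hg : ∀ a b, g (q a b) = q' (g₁ a) (g₂ b))
    (x : M₁ ⊗[k] N₁) (y : M₂ ⊗[k] N₂) :
    map f g (map₂ p q x y) = map₂ p' q' (map f₁ g₁ x) (map f₂ g₂ y) := by
  induction x with
  | zero => simp
  | add x x' hx hx' => simp only [map_add, LinearMap.add_apply, hx, hx']
  | tmul a b =>
    induction y with
    | zero => simp
    | add y y' hy hy' => simp only [map_add, hy, hy']
    | tmul c d => simp [hf, hg]

lemma assoc_map₂_tetra
    (p : M₁ →ₗ[k] M₂ →ₗ[k] M₃) (q : N₁ →ₗ[k] N₂ →ₗ[k] N₃) (r : L₁ →ₗ[k] L₂ →ₗ[k] L₃)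
    (x : (M₁ ⊗[k] N₁) ⊗[k] L₁) (y : (M₂ ⊗[k] N₂) ⊗[k] L₂) :
    TensorProduct.assoc k M₃ N₃ L₃ (map₂ (map₂ p q) r x y) =
      map₂ p (map₂ q r) (TensorProduct.assoc k M₁ N₁ L₁ x)
        (TensorProduct.assoc k M₂ N₂ L₂ y) := by
  induction x with
  | zero => simp
  | add x x' hx hx' => simp only [map_add, LinearMap.add_apply, hx, hx']
  | tmul a l =>
    induction a with
    | zero => simp
    | add x x' hx hx' => simp only [map_add, LinearMap.add_apply, hx, hx', add_tmul]
    | tmul a b =>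
      induction y with
      | zero => simp
      | add y y' hy hy' => simp only [map_add, hy, hy']
      | tmul c d =>
        induction c with
        | zero => simp
        | add x x' hx hx' => simp only [map_add, hx, hx', add_tmul]
        | tmul a b => simp

lemma assoc_symm_map₂_tetra
    (p : M₁ →ₗ[k] M₂ →ₗ[k] M₃) (q : N₁ →ₗ[k] N₂ →ₗ[k] N₃) (r : L₁ →ₗ[k] L₂ →ₗ[k] L₃)
    (x : M₁ ⊗[k] (N₁ ⊗[k] L₁)) (y : M₂ ⊗[k] (N₂ ⊗[k] L₂)) :
    (TensorProduct.assoc k M₃ N₃ L₃).symm (map₂ p (map₂ q r) x y) =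
      map₂ (map₂ p q) r ((TensorProduct.assoc k M₁ N₁ L₁).symm x)
        ((TensorProduct.assoc k M₂ N₂ L₂).symm y) := by
  rw [LinearEquiv.symm_apply_eq, assoc_map₂_tetra]
  simp

/-- A pair of "mixed associativity" identities passes to tensor products. -/
lemma map₂_map₂_tetra
    {p : M₁ →ₗ[k] M₂ →ₗ[k] M₃} {p' : M₃ →ₗ[k] M₄ →ₗ[k] M₅}
    {r : M₂ →ₗ[k] M₄ →ₗ[k] M₆} {r' : M₁ →ₗ[k] M₆ →ₗ[k] M₅}
    {q : N₁ →ₗ[k] N₂ →ₗ[k] N₃} {q' : N₃ →ₗ[k] N₄ →ₗ[k] N₅}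
    {s : N₂ →ₗ[k] N₄ →ₗ[k] N₆} {s' : N₁ →ₗ[k] N₆ →ₗ[k] N₅}
    (h : ∀ a b c, p' (p a b) c = r' a (r b c)) (h' : ∀ a b c, q' (q a b) c = s' a (s b c))
    (x : M₁ ⊗[k] N₁) (y : M₂ ⊗[k] N₂) (z : M₄ ⊗[k] N₄) :
    map₂ p' q' (map₂ p q x y) z = map₂ r' s' x (map₂ r s y z) := by
  induction x with
  | zero => simp
  | add x x' hx hx' => simp only [map_add, LinearMap.add_apply, hx, hx']
  | tmul a b =>
    induction y with
    | zero => simp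
    | add y y' hy hy' => simp only [map_add, LinearMap.add_apply, hy, hy']
    | tmul c d =>
      induction z with
      | zero => simp
      | add y y' hy hy' => simp only [map_add, hy, hy']
      | tmul e f => simp [h, h']

/-- A pair of "mixed commutativity" identities passes to tensor products. -/
lemma map₂_comm_tetra
    {p : M₂ →ₗ[k] M₄ →ₗ[k] M₃} {p' : M₁ →ₗ[k] M₃ →ₗ[k] M₅}
    {r : M₁ →ₗ[k] M₄ →ₗ[k] M₆} {r' : M₂ →ₗ[k] M₆ →ₗ[k] M₅}
    {q : N₂ →ₗ[k] N₄ →ₗ[k] N₃} {q' : N₁ →ₗ[k] N₃ →ₗ[k] N₅}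
    {s : N₁ →ₗ[k] N₄ →ₗ[k] N₆} {s' : N₂ →ₗ[k] N₆ →ₗ[k] N₅}
    (h : ∀ a b c, p' a (p b c) = r' b (r a c)) (h' : ∀ a b c, q' a (q b c) = s' b (s a c))
    (x : M₁ ⊗[k] N₁) (y : M₂ ⊗[k] N₂) (z : M₄ ⊗[k] N₄) :
    map₂ p' q' x (map₂ p q y z) = map₂ r' s' y (map₂ r s x z) := by
  induction x with
  | zero => simp
  | add x x' hx hx' => simp only [map_add, LinearMap.add_apply, hx, hx']
  | tmul a b =>
    induction y with
    | zero => simp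
    | add y y' hy hy' => simp only [map_add, LinearMap.add_apply, hy, hy']
    | tmul c d =>
      induction z with
      | zero => simp
      | add y y' hy hy' => simp only [map_add, hy, hy']
      | tmul e f => simp [h, h']

lemma rTensor_lTensor_tetra (g : M₁ →ₗ[k] M₂) (f : N₁ →ₗ[k] N₂) (z : M₁ ⊗[k] N₁) :
    g.rTensor N₂ (f.lTensor M₁ z) = f.lTensor M₂ (g.rTensor N₁ z) := by
  rw [← LinearMap.comp_apply, ← LinearMap.comp_apply, LinearMap.rTensor_comp_lTensor,
    LinearMap.lTensor_comp_rTensor]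

lemma map₂_mul_mul_tetra {A B : Type*} [Ring A] [Algebra k A] [Ring B] [Algebra k B]
    (x y : A ⊗[k] B) : map₂ (LinearMap.mul k A) (LinearMap.mul k B) x y = x * y := by
  induction x with
  | zero => simp
  | add x x' hx hx' => simp only [map_add, LinearMap.add_apply, hx, hx', add_mul]
  | tmul a b =>
    induction y with
    | zero => simp
    | add y y' hy hy' => simp only [map_add, hy, hy', mul_add]
    | tmul c d => simp

lemma map₂_flip_mul_mul_tetra {A B : Type*} [Ring A] [Algebra k A] [Ring B] [Algebra k B]
    (x y : A ⊗[k] B) :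
    map₂ (LinearMap.mul k A).flip (LinearMap.mul k B).flip x y = y * x := by
  induction x with
  | zero => simp
  | add x x' hx hx' => simp only [map_add, LinearMap.add_apply, hx, hx', mul_add]
  | tmul a b =>
    induction y with
    | zero => simp
    | add y y' hy hy' => simp only [map_add, hy, hy', add_mul]
    | tmul c d => simp

end Aux

end TensorProduct

open TensorProduct in
/-- The four structure maps of a tetramodule on a vector space `M` over a bialgebra `A`. Here
`lact a m` is the left action `a * m`, `ract a m` is the right action `m * a`, and `lcoact`,
`rcoact` are the left and the right coaction. -/
structure TetraStr (k : Type v) (A M : Type u) [Field k] [Ring A] [Bialgebra k A]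
    [AddCommGroup M] [Module k M] where
  lact : A →ₗ[k] M →ₗ[k] M
  ract : A →ₗ[k] M →ₗ[k] M
  lcoact : M →ₗ[k] A ⊗[k] M
  rcoact : M →ₗ[k] M ⊗[k] A

namespace TetraStr

open TensorProduct

variable {k : Type v} {A : Type u} [Field k] [Ring A] [Bialgebra k A]
variable {M N P : Type u} [AddCommGroup M] [Module k M] [AddCommGroup N] [Module k N]
  [AddCommGroup P] [Module k P]

/-- The axioms of a tetramodule, evaluated at an element `m`: an (associative, unital) bimodule,
a (coassociative, counital) bicomodule, and the four compatibilities
`Δ_ℓ (a * m) = Δ¹(a) * Δ_ℓ¹(m) ⊗ Δ²(a) * Δ_ℓ²(m)`, etc. They are required to hold at all `m`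
in the definition `Tetra` below. -/
structure LawfulAt (S : TetraStr k A M) (m : M) : Prop where
  one_lact : S.lact 1 m = m
  mul_lact (a b : A) : S.lact (a * b) m = S.lact a (S.lact b m)
  one_ract : S.ract 1 m = m
  mul_ract (a b : A) : S.ract (a * b) m = S.ract b (S.ract a m)
  lact_ract (a b : A) : S.lact a (S.ract b m) = S.ract b (S.lact a m)
  lcoact_counit : (Coalgebra.counit (R := k) (A := A)).rTensor M (S.lcoact m) = 1 ⊗ₜ[k] m
  lcoact_coassoc : TensorProduct.assoc k A A M
    ((Coalgebra.comul (R := k) (A := A)).rTensor M (S.lcoact m)) = S.lcoact.lTensor A (S.lcoact m)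
  rcoact_counit : (Coalgebra.counit (R := k) (A := A)).lTensor M (S.rcoact m) = m ⊗ₜ[k] 1
  rcoact_coassoc : TensorProduct.assoc k M A A (S.rcoact.rTensor A (S.rcoact m)) =
    (Coalgebra.comul (R := k) (A := A)).lTensor M (S.rcoact m)
  lcoact_rcoact : TensorProduct.assoc k A M A (S.lcoact.rTensor A (S.rcoact m)) =
    S.rcoact.lTensor A (S.lcoact m)
  lcoact_lact (a : A) : S.lcoact (S.lact a m) =
    map₂ (LinearMap.mul k A) S.lact (Coalgebra.comul (R := k) a) (S.lcoact m)
  lcoact_ract (a : A) : S.lcoact (S.ract a m) =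
    map₂ (LinearMap.mul k A).flip S.ract (Coalgebra.comul (R := k) a) (S.lcoact m)
  rcoact_lact (a : A) : S.rcoact (S.lact a m) =
    map₂ S.lact (LinearMap.mul k A) (Coalgebra.comul (R := k) a) (S.rcoact m)
  rcoact_ract (a : A) : S.rcoact (S.ract a m) =
    map₂ S.ract (LinearMap.mul k A).flip (Coalgebra.comul (R := k) a) (S.rcoact m)

/-- The space of morphisms of tetramodules: linear maps commuting with the two actions and
with the two coactions. -/
def homs (S : TetraStr k A M) (T : TetraStr k A N) : Submodule k (M →ₗ[k] N) where
  carrier := {f | (∀ a m, f (S.lact a m) = T.lact a (f m)) ∧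
    (∀ a m, f (S.ract a m) = T.ract a (f m)) ∧
    (∀ m, T.lcoact (f m) = f.lTensor A (S.lcoact m)) ∧
    (∀ m, T.rcoact (f m) = f.rTensor A (S.rcoact m))}
  add_mem' := by
    rintro f g ⟨h₁, h₂, h₃, h₄⟩ ⟨h₁', h₂', h₃', h₄'⟩
    refine ⟨?_, ?_, ?_, ?_⟩ <;>
      simp_all [LinearMap.lTensor_add, LinearMap.rTensor_add]
  zero_mem' := by simp
  smul_mem' := by
    rintro c f ⟨h₁, h₂, h₃, h₄⟩
    refine ⟨?_, ?_, ?_, ?_⟩ <;>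
      simp_all [LinearMap.lTensor_smul, LinearMap.rTensor_smul]

section Transfer

variable {S : TetraStr k A M} {T : TetraStr k A N} {U : TetraStr k A P}

lemma LawfulAt.zero : S.LawfulAt 0 where
  one_lact := by simp
  mul_lact := by simp
  one_ract := by simp
  mul_ract := by simp
  lact_ract := by simp
  lcoact_counit := by simp
  lcoact_coassoc := by simp
  rcoact_counit := by simp
  rcoact_coassoc := by simp
  lcoact_rcoact := by simp
  lcoact_lact := by simp
  lcoact_ract := by simp
  rcoact_lact := by simp
  rcoact_ract := by simp

lemma LawfulAt.add {m m' : M} (h : S.LawfulAt m) (h' : S.LawfulAt m') : S.LawfulAt (m + m') where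
  one_lact := by simp only [map_add, h.one_lact, h'.one_lact]
  mul_lact a b := by simp only [map_add, h.mul_lact, h'.mul_lact]
  one_ract := by simp only [map_add, h.one_ract, h'.one_ract]
  mul_ract a b := by simp only [map_add, h.mul_ract, h'.mul_ract]
  lact_ract a b := by simp only [map_add, h.lact_ract, h'.lact_ract]
  lcoact_counit := by simp only [map_add, h.lcoact_counit, h'.lcoact_counit, tmul_add]
  lcoact_coassoc := by simp only [map_add, h.lcoact_coassoc, h'.lcoact_coassoc]
  rcoact_counit := by simp only [map_add, h.rcoact_counit, h'.rcoact_counit, add_tmul]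
  rcoact_coassoc := by simp only [map_add, h.rcoact_coassoc, h'.rcoact_coassoc]
  lcoact_rcoact := by simp only [map_add, h.lcoact_rcoact, h'.lcoact_rcoact]
  lcoact_lact a := by simp only [map_add, h.lcoact_lact, h'.lcoact_lact]
  lcoact_ract a := by simp only [map_add, h.lcoact_ract, h'.lcoact_ract]
  rcoact_lact a := by simp only [map_add, h.rcoact_lact, h'.rcoact_lact]
  rcoact_ract a := by simp only [map_add, h.rcoact_ract, h'.rcoact_ract]

variable {f : M →ₗ[k] N}

lemma lcoact_comp_of_mem (hf : f ∈ homs S T) : T.lcoact ∘ₗ f = f.lTensor A ∘ₗ S.lcoact :=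
  LinearMap.ext hf.2.2.1

lemma rcoact_comp_of_mem (hf : f ∈ homs S T) : T.rcoact ∘ₗ f = f.rTensor A ∘ₗ S.rcoact :=
  LinearMap.ext hf.2.2.2

/-- The two sides of every axiom are natural with respect to morphisms. -/
lemma natural_of_mem (hf : f ∈ homs S T) (m : M) :
    ((Coalgebra.counit (R := k) (A := A)).rTensor N (T.lcoact (f m)) =
      f.lTensor k ((Coalgebra.counit (R := k) (A := A)).rTensor M (S.lcoact m))) ∧
    (TensorProduct.assoc k A A N
        ((Coalgebra.comul (R := k) (A := A)).rTensor N (T.lcoact (f m))) =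
      (f.lTensor A).lTensor A (TensorProduct.assoc k A A M
        ((Coalgebra.comul (R := k) (A := A)).rTensor M (S.lcoact m)))) ∧
    (T.lcoact.lTensor A (T.lcoact (f m)) =
      (f.lTensor A).lTensor A (S.lcoact.lTensor A (S.lcoact m))) ∧
    ((Coalgebra.counit (R := k) (A := A)).lTensor N (T.rcoact (f m)) =
      f.rTensor k ((Coalgebra.counit (R := k) (A := A)).lTensor M (S.rcoact m))) ∧
    (TensorProduct.assoc k N A A (T.rcoact.rTensor A (T.rcoact (f m))) =
      f.rTensor (A ⊗[k] A) (TensorProduct.assoc k M A A (S.rcoact.rTensor A (S.rcoact m)))) ∧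
    ((Coalgebra.comul (R := k) (A := A)).lTensor N (T.rcoact (f m)) =
      f.rTensor (A ⊗[k] A) ((Coalgebra.comul (R := k) (A := A)).lTensor M (S.rcoact m))) ∧
    (TensorProduct.assoc k A N A (T.lcoact.rTensor A (T.rcoact (f m))) =
      (f.rTensor A).lTensor A (TensorProduct.assoc k A M A (S.lcoact.rTensor A (S.rcoact m)))) ∧
    (T.rcoact.lTensor A (T.lcoact (f m)) =
      (f.rTensor A).lTensor A (S.rcoact.lTensor A (S.lcoact m))) := by
  have hl := lcoact_comp_of_mem hf
  have hr := rcoact_comp_of_mem hf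
  have e₁ : ∀ z : A ⊗[k] M, T.lcoact.lTensor A (f.lTensor A z) =
      (f.lTensor A).lTensor A (S.lcoact.lTensor A z) := fun z => by
    rw [← LinearMap.lTensor_comp_apply, hl, LinearMap.lTensor_comp_apply]
  have e₂ : ∀ z : M ⊗[k] A, T.rcoact.rTensor A (f.rTensor A z) =
      (f.rTensor A).rTensor A (S.rcoact.rTensor A z) := fun z => by
    rw [← LinearMap.rTensor_comp_apply, hr, LinearMap.rTensor_comp_apply]
  have e₃ : ∀ z : M ⊗[k] A, T.lcoact.rTensor A (f.rTensor A z) =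
      (f.lTensor A).rTensor A (S.lcoact.rTensor A z) := fun z => by
    rw [← LinearMap.rTensor_comp_apply, hl, LinearMap.rTensor_comp_apply]
  have e₄ : ∀ z : A ⊗[k] M, T.rcoact.lTensor A (f.lTensor A z) =
      (f.rTensor A).lTensor A (S.rcoact.lTensor A z) := fun z => by
    rw [← LinearMap.lTensor_comp_apply, hr, LinearMap.lTensor_comp_apply]
  have a₁ : ∀ z : (A ⊗[k] A) ⊗[k] M, TensorProduct.assoc k A A N (f.lTensor (A ⊗[k] A) z) =
      (f.lTensor A).lTensor A (TensorProduct.assoc k A A M z) := fun z => by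
    refine LinearMap.congr_fun (f := (TensorProduct.assoc k A A N).toLinearMap ∘ₗ
      f.lTensor (A ⊗[k] A)) (g := (f.lTensor A).lTensor A ∘ₗ
      (TensorProduct.assoc k A A M).toLinearMap) ?_ z
    ext; simp
  have a₂ : ∀ z : (M ⊗[k] A) ⊗[k] A, TensorProduct.assoc k N A A ((f.rTensor A).rTensor A z) =
      f.rTensor (A ⊗[k] A) (TensorProduct.assoc k M A A z) := fun z => by
    refine LinearMap.congr_fun (f := (TensorProduct.assoc k N A A).toLinearMap ∘ₗ
      (f.rTensor A).rTensor A) (g := f.rTensor (A ⊗[k] A) ∘ₗ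
      (TensorProduct.assoc k M A A).toLinearMap) ?_ z
    ext; simp
  have a₃ : ∀ z : (A ⊗[k] M) ⊗[k] A, TensorProduct.assoc k A N A ((f.lTensor A).rTensor A z) =
      (f.rTensor A).lTensor A (TensorProduct.assoc k A M A z) := fun z => by
    refine LinearMap.congr_fun (f := (TensorProduct.assoc k A N A).toLinearMap ∘ₗ
      (f.lTensor A).rTensor A) (g := (f.rTensor A).lTensor A ∘ₗ
      (TensorProduct.assoc k A M A).toLinearMap) ?_ z
    ext; simp
  rw [hf.2.2.1, hf.2.2.2]
  refine ⟨?_, ?_, e₁ _, ?_, ?_, ?_, ?_, e₄ _⟩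
  · exact rTensor_lTensor_tetra _ _ _
  · rw [← a₁, rTensor_lTensor_tetra]
  · exact (rTensor_lTensor_tetra _ _ _).symm
  · rw [e₂, a₂]
  · exact (rTensor_lTensor_tetra _ _ _).symm
  · rw [e₃, a₃]

lemma lTensor_map₂_of_mem (hf : f ∈ homs S T) (x : A ⊗[k] A) (y : A ⊗[k] M) :
    f.lTensor A (map₂ (LinearMap.mul k A) S.lact x y) =
      map₂ (LinearMap.mul k A) T.lact x (f.lTensor A y) ∧
    f.lTensor A (map₂ (LinearMap.mul k A).flip S.ract x y) =
      map₂ (LinearMap.mul k A).flip T.ract x (f.lTensor A y) := by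
  constructor
  · simpa [LinearMap.lTensor] using map_map₂_tetra (k := k) (p' := LinearMap.mul k A) (q' := T.lact)
      (f := LinearMap.id) (f₁ := LinearMap.id) (f₂ := LinearMap.id) (g₁ := LinearMap.id)
      (p := LinearMap.mul k A) (q := S.lact) (g := f) (g₂ := f) (by simp) hf.1 x y
  · simpa [LinearMap.lTensor] using map_map₂_tetra (k := k) (p' := (LinearMap.mul k A).flip) (q' := T.ract)
      (f := LinearMap.id) (f₁ := LinearMap.id) (f₂ := LinearMap.id) (g₁ := LinearMap.id)
      (p := (LinearMap.mul k A).flip) (q := S.ract) (g := f) (g₂ := f) (by simp) hf.2.1 x y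

lemma rTensor_map₂_of_mem (hf : f ∈ homs S T) (x : A ⊗[k] A) (y : M ⊗[k] A) :
    f.rTensor A (map₂ S.lact (LinearMap.mul k A) x y) =
      map₂ T.lact (LinearMap.mul k A) x (f.rTensor A y) ∧
    f.rTensor A (map₂ S.ract (LinearMap.mul k A).flip x y) =
      map₂ T.ract (LinearMap.mul k A).flip x (f.rTensor A y) := by
  constructor
  · simpa [LinearMap.rTensor] using map_map₂_tetra (k := k) (q' := LinearMap.mul k A) (p' := T.lact)
      (g := LinearMap.id) (f₁ := LinearMap.id) (g₂ := LinearMap.id) (g₁ := LinearMap.id)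
      (q := LinearMap.mul k A) (p := S.lact) (f := f) (f₂ := f) hf.1 (by simp) x y
  · simpa [LinearMap.rTensor] using map_map₂_tetra (k := k) (q' := (LinearMap.mul k A).flip) (p' := T.ract)
      (g := LinearMap.id) (f₁ := LinearMap.id) (g₂ := LinearMap.id) (g₁ := LinearMap.id)
      (q := (LinearMap.mul k A).flip) (p := S.ract) (f := f) (f₂ := f) hf.2.1 (by simp) x y

/-- The axioms pass to images. -/
lemma LawfulAt.map (hf : f ∈ homs S T) {m : M} (h : S.LawfulAt m) : T.LawfulAt (f m) := by
  obtain ⟨n₁, n₂, n₃, n₄, n₅, n₆, n₇, n₈⟩ := natural_of_mem hf m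
  constructor
  · rw [← hf.1, h.one_lact]
  · intro a b; rw [← hf.1, ← hf.1, ← hf.1, h.mul_lact]
  · rw [← hf.2.1, h.one_ract]
  · intro a b; rw [← hf.2.1, ← hf.2.1, ← hf.2.1, h.mul_ract]
  · intro a b; rw [← hf.2.1, ← hf.1, ← hf.1, ← hf.2.1, h.lact_ract]
  · rw [n₁, h.lcoact_counit]; simp
  · rw [n₂, n₃, h.lcoact_coassoc]
  · rw [n₄, h.rcoact_counit]; simp
  · rw [n₅, n₆, h.rcoact_coassoc]
  · rw [n₇, n₈, h.lcoact_rcoact]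
  · intro a
    rw [← hf.1, hf.2.2.1, hf.2.2.1, h.lcoact_lact, (lTensor_map₂_of_mem hf _ _).1]
  · intro a
    rw [← hf.2.1, hf.2.2.1, hf.2.2.1, h.lcoact_ract, (lTensor_map₂_of_mem hf _ _).2]
  · intro a
    rw [← hf.1, hf.2.2.2, hf.2.2.2, h.rcoact_lact, (rTensor_map₂_of_mem hf _ _).1]
  · intro a
    rw [← hf.2.1, hf.2.2.2, hf.2.2.2, h.rcoact_ract, (rTensor_map₂_of_mem hf _ _).2]

/-- The axioms are reflected by injective morphisms. -/
lemma LawfulAt.of_map (hf : f ∈ homs S T) (hi : Function.Injective f) {m : M}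
    (h : T.LawfulAt (f m)) : S.LawfulAt m := by
  obtain ⟨n₁, n₂, n₃, n₄, n₅, n₆, n₇, n₈⟩ := natural_of_mem hf m
  have il {V : Type u} [AddCommGroup V] [Module k V] : Function.Injective (f.lTensor V) :=
    Module.Flat.lTensor_preserves_injective_linearMap f hi
  have ir {V : Type u} [AddCommGroup V] [Module k V] : Function.Injective (f.rTensor V) :=
    Module.Flat.rTensor_preserves_injective_linearMap f hi
  constructor
  · apply hi; rw [hf.1, h.one_lact]
  · intro a b; apply hi; rw [hf.1, hf.1, hf.1, h.mul_lact]
  · apply hi; rw [hf.2.1, h.one_ract]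
  · intro a b; apply hi; rw [hf.2.1, hf.2.1, hf.2.1, h.mul_ract]
  · intro a b; apply hi; rw [hf.2.1, hf.1, hf.1, hf.2.1, h.lact_ract]
  · apply Module.Flat.lTensor_preserves_injective_linearMap (M := k) f hi
    rw [← n₁, h.lcoact_counit]; simp
  · apply Module.Flat.lTensor_preserves_injective_linearMap (M := A) (f.lTensor A) il
    rw [← n₂, ← n₃, h.lcoact_coassoc]
  · apply Module.Flat.rTensor_preserves_injective_linearMap (M := k) f hi
    rw [← n₄, h.rcoact_counit]; simp
  · apply ir
    rw [← n₅, ← n₆, h.rcoact_coassoc]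
  · apply Module.Flat.lTensor_preserves_injective_linearMap (M := A) (f.rTensor A) ir
    rw [← n₇, ← n₈, h.lcoact_rcoact]
  · intro a; apply il
    rw [← hf.2.2.1, hf.1, (lTensor_map₂_of_mem hf _ _).1, ← hf.2.2.1, h.lcoact_lact]
  · intro a; apply il
    rw [← hf.2.2.1, hf.2.1, (lTensor_map₂_of_mem hf _ _).2, ← hf.2.2.1, h.lcoact_ract]
  · intro a; apply ir
    rw [← hf.2.2.2, hf.1, (rTensor_map₂_of_mem hf _ _).1, ← hf.2.2.2, h.rcoact_lact]
  · intro a; apply ir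
    rw [← hf.2.2.2, hf.2.1, (rTensor_map₂_of_mem hf _ _).2, ← hf.2.2.2, h.rcoact_ract]

lemma id_mem : (LinearMap.id : M →ₗ[k] M) ∈ homs S S := by
  refine ⟨?_, ?_, ?_, ?_⟩ <;> simp

lemma comp_mem {g : N →ₗ[k] P} (hf : f ∈ homs S T) (hg : g ∈ homs T U) :
    g ∘ₗ f ∈ homs S U := by
  refine ⟨fun a m => ?_, fun a m => ?_, fun m => ?_, fun m => ?_⟩
  · simp [hf.1, hg.1]
  · simp [hf.2.1, hg.2.1]
  · simp [hf.2.2.1, hg.2.2.1, LinearMap.lTensor_comp]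
  · simp [hf.2.2.2, hg.2.2.2, LinearMap.rTensor_comp]

/-- A linear map which becomes a morphism after composition with an injective morphism
is a morphism. -/
lemma mem_of_comp_mem_left {g : N →ₗ[k] P} (hg : g ∈ homs T U) (hi : Function.Injective g)
    (h : g ∘ₗ f ∈ homs S U) : f ∈ homs S T := by
  refine ⟨fun a m => hi ?_, fun a m => hi ?_, fun m => ?_, fun m => ?_⟩
  · rw [hg.1]; exact h.1 a m
  · rw [hg.2.1]; exact h.2.1 a m
  · apply Module.Flat.lTensor_preserves_injective_linearMap (M := A) g hi
    rw [← hg.2.2.1, ← LinearMap.lTensor_comp_apply]; exact h.2.2.1 m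
  · apply Module.Flat.rTensor_preserves_injective_linearMap (M := A) g hi
    rw [← hg.2.2.2, ← LinearMap.rTensor_comp_apply]; exact h.2.2.2 m

/-- A linear map which becomes a morphism after composition with a surjective morphism
is a morphism. -/
lemma mem_of_comp_mem_right {g : N →ₗ[k] P} (hf : f ∈ homs S T) (hs : Function.Surjective f)
    (h : g ∘ₗ f ∈ homs S U) : g ∈ homs T U := by
  refine ⟨fun a n => ?_, fun a n => ?_, fun n => ?_, fun n => ?_⟩ <;>
    obtain ⟨m, rfl⟩ := hs n
  · rw [← hf.1]; exact h.1 a m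
  · rw [← hf.2.1]; exact h.2.1 a m
  · rw [hf.2.2.1, ← LinearMap.lTensor_comp_apply]; exact h.2.2.1 m
  · rw [hf.2.2.2, ← LinearMap.rTensor_comp_apply]; exact h.2.2.2 m

end Transfer

section SubQuotient

variable {S : TetraStr k A M} {T : TetraStr k A N}

/-- A subspace stable under all structure maps carries induced structure maps. -/
lemma exists_sub {ι : P →ₗ[k] M} (hi : Function.Injective ι)
    (h₁ : ∀ a x, S.lact a (ι x) ∈ LinearMap.range ι)
    (h₂ : ∀ a x, S.ract a (ι x) ∈ LinearMap.range ι)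
    (h₃ : ∀ x, S.lcoact (ι x) ∈ LinearMap.range (ι.lTensor A))
    (h₄ : ∀ x, S.rcoact (ι x) ∈ LinearMap.range (ι.rTensor A)) :
    ∃ U : TetraStr k A P, ι ∈ homs U S := by
  obtain ⟨r, hr⟩ := LinearMap.exists_leftInverse_of_injective ι (LinearMap.ker_eq_bot.2 hi)
  have hr' : ∀ x, r (ι x) = x := fun x => LinearMap.congr_fun hr x
  refine ⟨⟨(S.lact.compl₂ ι).compr₂ r, (S.ract.compl₂ ι).compr₂ r,
    r.lTensor A ∘ₗ S.lcoact ∘ₗ ι, r.rTensor A ∘ₗ S.rcoact ∘ₗ ι⟩, ?_, ?_, ?_, ?_⟩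
  · intro a x
    obtain ⟨y, hy⟩ := h₁ a x
    simp [← hy, hr']
  · intro a x
    obtain ⟨y, hy⟩ := h₂ a x
    simp [← hy, hr']
  · intro x
    obtain ⟨y, hy⟩ := h₃ x
    simp only [LinearMap.comp_apply, ← hy]
    rw [← LinearMap.lTensor_comp_apply A r ι, hr]
    simp
  · intro x
    obtain ⟨y, hy⟩ := h₄ x
    simp only [LinearMap.comp_apply, ← hy]
    rw [← LinearMap.rTensor_comp_apply A r ι, hr]
    simp

/-- A quotient by a subspace stable under all structure maps carries induced structure maps. -/
lemma exists_quot {π : M →ₗ[k] P} (hs : Function.Surjective π)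
    (h₁ : ∀ a m, π m = 0 → π (S.lact a m) = 0)
    (h₂ : ∀ a m, π m = 0 → π (S.ract a m) = 0)
    (h₃ : ∀ m, π m = 0 → π.lTensor A (S.lcoact m) = 0)
    (h₄ : ∀ m, π m = 0 → π.rTensor A (S.rcoact m) = 0) :
    ∃ U : TetraStr k A P, π ∈ homs S U := by
  obtain ⟨s, hr⟩ := LinearMap.exists_rightInverse_of_surjective π (LinearMap.range_eq_top.2 hs)
  have hr' : ∀ m, π (m - s (π m)) = 0 := fun m => by
    have := LinearMap.congr_fun hr (π m)
    simp only [LinearMap.comp_apply, LinearMap.id_apply] at this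
    rw [map_sub, this, sub_self]
  refine ⟨⟨(S.lact.compl₂ s).compr₂ π, (S.ract.compl₂ s).compr₂ π,
    π.lTensor A ∘ₗ S.lcoact ∘ₗ s, π.rTensor A ∘ₗ S.rcoact ∘ₗ s⟩, ?_, ?_, ?_, ?_⟩
  · intro a m
    have := h₁ a _ (hr' m)
    rw [map_sub, map_sub, sub_eq_zero] at this
    simpa using this
  · intro a m
    have := h₂ a _ (hr' m)
    rw [map_sub, map_sub, sub_eq_zero] at this
    simpa using this
  · intro m
    have := h₃ _ (hr' m)
    rw [map_sub, map_sub, sub_eq_zero] at this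
    simpa using this.symm
  · intro m
    have := h₄ _ (hr' m)
    rw [map_sub, map_sub, sub_eq_zero] at this
    simpa using this.symm

lemma exists_ker {f : M →ₗ[k] N} (hf : f ∈ homs S T) :
    ∃ U : TetraStr k A (LinearMap.ker f), (LinearMap.ker f).subtype ∈ homs U S := by
  have ex := LinearMap.exact_subtype_ker_map f
  refine exists_sub (Submodule.injective_subtype _) ?_ ?_ ?_ ?_
  · intro a x
    simp only [Submodule.range_subtype, LinearMap.mem_ker, hf.1]
    simp
  · intro a x
    simp only [Submodule.range_subtype, LinearMap.mem_ker, hf.2.1]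
    simp
  · intro x
    refine (Module.Flat.lTensor_exact A ex _).1 ?_
    rw [← hf.2.2.1]
    simp
  · intro x
    refine (Module.Flat.rTensor_exact A ex _).1 ?_
    rw [← hf.2.2.2]
    simp

lemma exists_coker {f : M →ₗ[k] N} (hf : f ∈ homs S T) :
    ∃ U : TetraStr k A (N ⧸ LinearMap.range f), (LinearMap.range f).mkQ ∈ homs T U := by
  refine exists_quot (Submodule.mkQ_surjective _) ?_ ?_ ?_ ?_
  · intro a m hm
    simp only [Submodule.mkQ_apply, Submodule.Quotient.mk_eq_zero] at hm ⊢
    obtain ⟨y, rfl⟩ := hm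
    rw [← hf.1]; exact ⟨_, rfl⟩
  · intro a m hm
    simp only [Submodule.mkQ_apply, Submodule.Quotient.mk_eq_zero] at hm ⊢
    obtain ⟨y, rfl⟩ := hm
    rw [← hf.2.1]; exact ⟨_, rfl⟩
  · intro m hm
    simp only [Submodule.mkQ_apply, Submodule.Quotient.mk_eq_zero] at hm
    obtain ⟨y, rfl⟩ := hm
    rw [hf.2.2.1, ← LinearMap.lTensor_comp_apply, LinearMap.range_mkQ_comp]
    simp
  · intro m hm
    simp only [Submodule.mkQ_apply, Submodule.Quotient.mk_eq_zero] at hm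
    obtain ⟨y, rfl⟩ := hm
    rw [hf.2.2.2, ← LinearMap.rTensor_comp_apply, LinearMap.range_mkQ_comp]
    simp

end SubQuotient

/-- The direct sum of two tetramodules. -/
def prod (S : TetraStr k A M) (T : TetraStr k A N) : TetraStr k A (M × N) where
  lact := (S.lact.compl₂ (LinearMap.fst k M N)).compr₂ (LinearMap.inl k M N) +
    (T.lact.compl₂ (LinearMap.snd k M N)).compr₂ (LinearMap.inr k M N)
  ract := (S.ract.compl₂ (LinearMap.fst k M N)).compr₂ (LinearMap.inl k M N) +
    (T.ract.compl₂ (LinearMap.snd k M N)).compr₂ (LinearMap.inr k M N)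
  lcoact := (LinearMap.inl k M N).lTensor A ∘ₗ S.lcoact ∘ₗ LinearMap.fst k M N +
    (LinearMap.inr k M N).lTensor A ∘ₗ T.lcoact ∘ₗ LinearMap.snd k M N
  rcoact := (LinearMap.inl k M N).rTensor A ∘ₗ S.rcoact ∘ₗ LinearMap.fst k M N +
    (LinearMap.inr k M N).rTensor A ∘ₗ T.rcoact ∘ₗ LinearMap.snd k M N

section Prod

variable (S : TetraStr k A M) (T : TetraStr k A N)

lemma inl_mem : LinearMap.inl k M N ∈ homs S (S.prod T) := by
  refine ⟨?_, ?_, ?_, ?_⟩ <;> simp [prod]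

lemma inr_mem : LinearMap.inr k M N ∈ homs T (S.prod T) := by
  refine ⟨?_, ?_, ?_, ?_⟩ <;> simp [prod]

lemma fst_mem : LinearMap.fst k M N ∈ homs (S.prod T) S := by
  refine ⟨?_, ?_, ?_, ?_⟩ <;>
    simp [prod, ← LinearMap.lTensor_comp_apply, ← LinearMap.rTensor_comp_apply]

lemma snd_mem : LinearMap.snd k M N ∈ homs (S.prod T) T := by
  refine ⟨?_, ?_, ?_, ?_⟩ <;>
    simp [prod, ← LinearMap.lTensor_comp_apply, ← LinearMap.rTensor_comp_apply]

end Prod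

/-- The structure maps of the tautological tetramodule `A`. -/
@[simps]
def self (k : Type v) (A : Type u) [Field k] [Ring A] [Bialgebra k A] : TetraStr k A A where
  lact := LinearMap.mul k A
  ract := (LinearMap.mul k A).flip
  lcoact := Coalgebra.comul
  rcoact := Coalgebra.comul

/-- The structure maps of the first external product `M ⊠₁ N`: the left action is that of `M`,
the right action is that of `N`, and
`Δ_ℓ (m ⊗ n) = (Δ_ℓ¹(m) * Δ_ℓ¹(n)) ⊗ (Δ_ℓ²(m) ⊗ Δ_ℓ²(n))`,
`Δ_r (m ⊗ n) = (Δ_r¹(m) ⊗ Δ_r¹(n)) ⊗ (Δ_r²(m) * Δ_r²(n))`. -/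
@[simps]
def boxOne (S : TetraStr k A M) (T : TetraStr k A N) : TetraStr k A (M ⊗[k] N) where
  lact := LinearMap.rTensorHom N ∘ₗ S.lact
  ract := LinearMap.lTensorHom M ∘ₗ T.ract
  lcoact := TensorProduct.lift
    ((map₂ (LinearMap.mul k A) (TensorProduct.mk k M N)).compl₁₂ S.lcoact T.lcoact)
  rcoact := TensorProduct.lift
    ((map₂ (TensorProduct.mk k M N) (LinearMap.mul k A)).compl₁₂ S.rcoact T.rcoact)

/-- The structure maps of the second external product `M ⊠₂ N`:
`a * (m ⊗ n) = (Δ¹(a) * m) ⊗ (Δ²(a) * n)`, `(m ⊗ n) * a = (m * Δ¹(a)) ⊗ (n * Δ²(a))`, the left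
coaction is that of `M` and the right coaction is that of `N`. -/
@[simps]
def boxTwo (S : TetraStr k A M) (T : TetraStr k A N) : TetraStr k A (M ⊗[k] N) where
  lact := map₂ S.lact T.lact ∘ₗ Coalgebra.comul
  ract := map₂ S.ract T.ract ∘ₗ Coalgebra.comul
  lcoact := (TensorProduct.assoc k A M N).toLinearMap ∘ₗ S.lcoact.rTensor N
  rcoact := (TensorProduct.assoc k M N A).symm.toLinearMap ∘ₗ T.rcoact.lTensor M

lemma self_lawful (a : A) : (self k A).LawfulAt a where
  one_lact := by simp
  mul_lact b c := by simp [mul_assoc]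
  one_ract := by simp
  mul_ract b c := by simp [mul_assoc]
  lact_ract b c := by simp [mul_assoc]
  lcoact_counit := by simp
  lcoact_coassoc := by simp
  rcoact_counit := by simp
  rcoact_coassoc := by simp
  lcoact_rcoact := by simp
  lcoact_lact b := by simp [map₂_mul_mul_tetra]
  lcoact_ract b := by simp [map₂_flip_mul_mul_tetra]
  rcoact_lact b := by simp [map₂_mul_mul_tetra]
  rcoact_ract b := by simp [map₂_flip_mul_mul_tetra]

section Box

variable {S : TetraStr k A M} {T : TetraStr k A N}

lemma lawful_of_tmul (U : TetraStr k A (M ⊗[k] N)) (h : ∀ m n, U.LawfulAt (m ⊗ₜ[k] n))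
    (z : M ⊗[k] N) : U.LawfulAt z := by
  induction z with
  | zero => exact .zero
  | tmul m n => exact h m n
  | add x y hx hy => exact hx.add hy

lemma boxOne_lawful (hS : ∀ m, S.LawfulAt m) (hT : ∀ n, T.LawfulAt n) (z : M ⊗[k] N) :
    (S.boxOne T).LawfulAt z := by
  refine lawful_of_tmul _ (fun m n => ?_) z
  constructor
  · simp [(hS m).one_lact]
  · simp [(hS m).mul_lact]
  · simp [(hT n).one_ract]
  · simp [(hT n).mul_ract]
  · simp
  · have := map_map₂_tetra (k := k) (p := LinearMap.mul k A) (q := TensorProduct.mk k M N)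
      (p' := LinearMap.mul k k) (q' := TensorProduct.mk k M N)
      (f := Coalgebra.counit) (g := LinearMap.id) (f₁ := Coalgebra.counit)
      (f₂ := Coalgebra.counit) (g₁ := LinearMap.id) (g₂ := LinearMap.id)
      (by simp) (by simp) (S.lcoact m) (T.lcoact n)
    have h₁ := (hS m).lcoact_counit
    have h₂ := (hT n).lcoact_counit
    simp only [LinearMap.rTensor] at h₁ h₂ ⊢
    simp [this, h₁, h₂]
  · have hx (x : A ⊗[k] M) (y : A ⊗[k] N) :
        TensorProduct.assoc k A A (M ⊗[k] N) (map Coalgebra.comul LinearMap.id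
          (map₂ (LinearMap.mul k A) (TensorProduct.mk k M N) x y)) =
        map₂ (LinearMap.mul k A) (map₂ (LinearMap.mul k A) (TensorProduct.mk k M N))
          (TensorProduct.assoc k A A M (map Coalgebra.comul LinearMap.id x))
          (TensorProduct.assoc k A A N (map Coalgebra.comul LinearMap.id y)) := by
      rw [← assoc_map₂_tetra]
      exact congrArg _ (map_map₂_tetra (by simp [map₂_mul_mul_tetra]) (by simp) x y)
    have hy (x : A ⊗[k] M) (y : A ⊗[k] N) :
        map LinearMap.id (S.boxOne T).lcoact
          (map₂ (LinearMap.mul k A) (TensorProduct.mk k M N) x y) =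
        map₂ (LinearMap.mul k A) (map₂ (LinearMap.mul k A) (TensorProduct.mk k M N))
          (map LinearMap.id S.lcoact x) (map LinearMap.id T.lcoact y) :=
      map_map₂_tetra (by simp) (by simp) x y
    have h₁ := (hS m).lcoact_coassoc
    have h₂ := (hT n).lcoact_coassoc
    simp only [LinearMap.rTensor, LinearMap.lTensor] at h₁ h₂ ⊢
    have e : (S.boxOne T).lcoact (m ⊗ₜ[k] n) =
      map₂ (LinearMap.mul k A) (TensorProduct.mk k M N) (S.lcoact m) (T.lcoact n) := by simp
    rw [e, hx, hy, h₁, h₂]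
  · have := map_map₂_tetra (k := k) (q := LinearMap.mul k A) (p := TensorProduct.mk k M N)
      (q' := LinearMap.mul k k) (p' := TensorProduct.mk k M N)
      (g := Coalgebra.counit) (f := LinearMap.id) (g₁ := Coalgebra.counit)
      (g₂ := Coalgebra.counit) (f₁ := LinearMap.id) (f₂ := LinearMap.id)
      (by simp) (by simp) (S.rcoact m) (T.rcoact n)
    have h₁ := (hS m).rcoact_counit
    have h₂ := (hT n).rcoact_counit
    simp only [LinearMap.lTensor] at h₁ h₂ ⊢
    simp [this, h₁, h₂]
  · have hx (x : M ⊗[k] A) (y : N ⊗[k] A) :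
        TensorProduct.assoc k (M ⊗[k] N) A A (map (S.boxOne T).rcoact LinearMap.id
          (map₂ (TensorProduct.mk k M N) (LinearMap.mul k A) x y)) =
        map₂ (TensorProduct.mk k M N) (map₂ (LinearMap.mul k A) (LinearMap.mul k A))
          (TensorProduct.assoc k M A A (map S.rcoact LinearMap.id x))
          (TensorProduct.assoc k N A A (map T.rcoact LinearMap.id y)) := by
      rw [← assoc_map₂_tetra]
      exact congrArg _ (map_map₂_tetra (by simp) (by simp) x y)
    have hy (x : M ⊗[k] A) (y : N ⊗[k] A) :
        map LinearMap.id Coalgebra.comul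
          (map₂ (TensorProduct.mk k M N) (LinearMap.mul k A) x y) =
        map₂ (TensorProduct.mk k M N) (map₂ (LinearMap.mul k A) (LinearMap.mul k A))
          (map LinearMap.id Coalgebra.comul x) (map LinearMap.id Coalgebra.comul y) :=
      map_map₂_tetra (by simp) (by simp [map₂_mul_mul_tetra]) x y
    have h₁ := (hS m).rcoact_coassoc
    have h₂ := (hT n).rcoact_coassoc
    simp only [LinearMap.rTensor, LinearMap.lTensor] at h₁ h₂ ⊢
    have e : (S.boxOne T).rcoact (m ⊗ₜ[k] n) =
      map₂ (TensorProduct.mk k M N) (LinearMap.mul k A) (S.rcoact m) (T.rcoact n) := by simp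
    rw [e, hx, hy, h₁, h₂]
  · have hx (x : M ⊗[k] A) (y : N ⊗[k] A) :
        TensorProduct.assoc k A (M ⊗[k] N) A (map (S.boxOne T).lcoact LinearMap.id
          (map₂ (TensorProduct.mk k M N) (LinearMap.mul k A) x y)) =
        map₂ (LinearMap.mul k A) (map₂ (TensorProduct.mk k M N) (LinearMap.mul k A))
          (TensorProduct.assoc k A M A (map S.lcoact LinearMap.id x))
          (TensorProduct.assoc k A N A (map T.lcoact LinearMap.id y)) := by
      rw [← assoc_map₂_tetra]
      exact congrArg _ (map_map₂_tetra (by simp) (by simp) x y)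
    have hy (x : A ⊗[k] M) (y : A ⊗[k] N) :
        map LinearMap.id (S.boxOne T).rcoact
          (map₂ (LinearMap.mul k A) (TensorProduct.mk k M N) x y) =
        map₂ (LinearMap.mul k A) (map₂ (TensorProduct.mk k M N) (LinearMap.mul k A))
          (map LinearMap.id S.rcoact x) (map LinearMap.id T.rcoact y) :=
      map_map₂_tetra (by simp) (by simp) x y
    have h₁ := (hS m).lcoact_rcoact
    have h₂ := (hT n).lcoact_rcoact
    simp only [LinearMap.rTensor, LinearMap.lTensor] at h₁ h₂ ⊢
    have e : (S.boxOne T).lcoact (m ⊗ₜ[k] n) =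
      map₂ (LinearMap.mul k A) (TensorProduct.mk k M N) (S.lcoact m) (T.lcoact n) := by simp
    have e' : (S.boxOne T).rcoact (m ⊗ₜ[k] n) =
      map₂ (TensorProduct.mk k M N) (LinearMap.mul k A) (S.rcoact m) (T.rcoact n) := by simp
    rw [e, e', hx, hy, h₁, h₂]
  · intro a
    have e : (S.boxOne T).lcoact ((S.boxOne T).lact a (m ⊗ₜ[k] n)) =
      map₂ (LinearMap.mul k A) (TensorProduct.mk k M N) (S.lcoact (S.lact a m)) (T.lcoact n) := by
      simp
    rw [e, (hS m).lcoact_lact]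
    exact map₂_map₂_tetra (by simp [mul_assoc]) (by simp) _ _ _
  · intro a
    have e : (S.boxOne T).lcoact ((S.boxOne T).ract a (m ⊗ₜ[k] n)) =
      map₂ (LinearMap.mul k A) (TensorProduct.mk k M N) (S.lcoact m) (T.lcoact (T.ract a n)) := by
      simp
    rw [e, (hT n).lcoact_ract]
    exact map₂_comm_tetra (by simp [mul_assoc]) (by simp) _ _ _
  · intro a
    have e : (S.boxOne T).rcoact ((S.boxOne T).lact a (m ⊗ₜ[k] n)) =
      map₂ (TensorProduct.mk k M N) (LinearMap.mul k A) (S.rcoact (S.lact a m)) (T.rcoact n) := by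
      simp
    rw [e, (hS m).rcoact_lact]
    exact map₂_map₂_tetra (by simp) (by simp [mul_assoc]) _ _ _
  · intro a
    have e : (S.boxOne T).rcoact ((S.boxOne T).ract a (m ⊗ₜ[k] n)) =
      map₂ (TensorProduct.mk k M N) (LinearMap.mul k A) (S.rcoact m) (T.rcoact (T.ract a n)) := by
      simp
    rw [e, (hT n).rcoact_ract]
    exact map₂_comm_tetra (by simp) (by simp [mul_assoc]) _ _ _

lemma boxTwo_lawful (hS : ∀ m, S.LawfulAt m) (hT : ∀ n, T.LawfulAt n) (z : M ⊗[k] N) :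
    (S.boxTwo T).LawfulAt z := by
  refine lawful_of_tmul _ (fun m n => ?_) z
  have el (m : M) (n : N) : (S.boxTwo T).lcoact (m ⊗ₜ[k] n) =
      TensorProduct.assoc k A M N (S.lcoact m ⊗ₜ[k] n) := by simp
  have er (m : M) (n : N) : (S.boxTwo T).rcoact (m ⊗ₜ[k] n) =
      (TensorProduct.assoc k M N A).symm (m ⊗ₜ[k] T.rcoact n) := by simp
  constructor
  · simp [Algebra.TensorProduct.one_def, (hS m).one_lact, (hT n).one_lact]
  · intro a b
    simp only [boxTwo_lact, LinearMap.comp_apply, Bialgebra.comul_mul]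
    rw [← map₂_mul_mul_tetra]
    exact map₂_map₂_tetra (fun a b m => (hS m).mul_lact a b) (fun a b n => (hT n).mul_lact a b)
      _ _ _
  · simp [Algebra.TensorProduct.one_def, (hS m).one_ract, (hT n).one_ract]
  · intro a b
    simp only [boxTwo_ract, LinearMap.comp_apply, Bialgebra.comul_mul]
    rw [← map₂_flip_mul_mul_tetra]
    exact map₂_map₂_tetra (fun a b m => (hS m).mul_ract b a) (fun a b n => (hT n).mul_ract b a)
      _ _ _
  · intro a b
    exact map₂_comm_tetra (fun a b m => (hS m).lact_ract a b) (fun a b n => (hT n).lact_ract a b)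
      _ _ _
  · have h (x : A ⊗[k] M) : (Coalgebra.counit (R := k) (A := A)).rTensor (M ⊗[k] N)
        (TensorProduct.assoc k A M N (x ⊗ₜ[k] n)) = TensorProduct.assoc k k M N
          ((Coalgebra.counit (R := k) (A := A)).rTensor M x ⊗ₜ[k] n) := by
      induction x with
      | zero => simp
      | add x y hx hy => simp only [add_tmul, map_add, hx, hy]
      | tmul x y => simp
    rw [el, h, (hS m).lcoact_counit]
    simp
  · have h (x : A ⊗[k] M) : (Coalgebra.comul (R := k) (A := A)).rTensor (M ⊗[k] N)
        (TensorProduct.assoc k A M N (x ⊗ₜ[k] n)) = TensorProduct.assoc k (A ⊗[k] A) M N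
          ((Coalgebra.comul (R := k) (A := A)).rTensor M x ⊗ₜ[k] n) := by
      induction x with
      | zero => simp
      | add x y hx hy => simp only [add_tmul, map_add, hx, hy]
      | tmul x y => simp
    have h' (x : A ⊗[k] M) : (S.boxTwo T).lcoact.lTensor A
        (TensorProduct.assoc k A M N (x ⊗ₜ[k] n)) =
        (TensorProduct.assoc k A M N).toLinearMap.lTensor A
          (TensorProduct.assoc k A (A ⊗[k] M) N (S.lcoact.lTensor A x ⊗ₜ[k] n)) := by
      induction x with
      | zero => simp
      | add x y hx hy => simp only [add_tmul, map_add, hx, hy]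
      | tmul x y => simp
    have h'' (x : (A ⊗[k] A) ⊗[k] M) :
        TensorProduct.assoc k A A (M ⊗[k] N) (TensorProduct.assoc k (A ⊗[k] A) M N (x ⊗ₜ[k] n)) =
        (TensorProduct.assoc k A M N).toLinearMap.lTensor A
          (TensorProduct.assoc k A (A ⊗[k] M) N (TensorProduct.assoc k A A M x ⊗ₜ[k] n)) := by
      induction x with
      | zero => simp
      | add x y hx hy => simp only [add_tmul, map_add, hx, hy]
      | tmul x y =>
        induction x with
        | zero => simp
        | add x y hx hy => simp only [add_tmul, map_add, hx, hy]
        | tmul x y => simp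
    rw [el, h, h', h'', (hS m).lcoact_coassoc]
  · have h (y : N ⊗[k] A) : (Coalgebra.counit (R := k) (A := A)).lTensor (M ⊗[k] N)
        ((TensorProduct.assoc k M N A).symm (m ⊗ₜ[k] y)) = (TensorProduct.assoc k M N k).symm
          (m ⊗ₜ[k] (Coalgebra.counit (R := k) (A := A)).lTensor N y) := by
      induction y with
      | zero => simp
      | add x y hx hy => simp only [tmul_add, map_add, hx, hy]
      | tmul x y => simp
    rw [er, h, (hT n).rcoact_counit]
    simp
  · have h (y : N ⊗[k] A) : (Coalgebra.comul (R := k) (A := A)).lTensor (M ⊗[k] N)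
        ((TensorProduct.assoc k M N A).symm (m ⊗ₜ[k] y)) =
        (TensorProduct.assoc k M N (A ⊗[k] A)).symm
          (m ⊗ₜ[k] (Coalgebra.comul (R := k) (A := A)).lTensor N y) := by
      induction y with
      | zero => simp
      | add x y hx hy => simp only [tmul_add, map_add, hx, hy]
      | tmul x y => simp
    have h' (y : N ⊗[k] A) : (S.boxTwo T).rcoact.rTensor A
        ((TensorProduct.assoc k M N A).symm (m ⊗ₜ[k] y)) =
        (TensorProduct.assoc k M N A).symm.toLinearMap.rTensor A
          ((TensorProduct.assoc k M (N ⊗[k] A) A).symm (m ⊗ₜ[k] T.rcoact.rTensor A y)) := by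
      induction y with
      | zero => simp
      | add x y hx hy => simp only [tmul_add, map_add, hx, hy]
      | tmul x y => simp
    have h'' (y : (N ⊗[k] A) ⊗[k] A) :
        TensorProduct.assoc k (M ⊗[k] N) A A
          ((TensorProduct.assoc k M N A).symm.toLinearMap.rTensor A
            ((TensorProduct.assoc k M (N ⊗[k] A) A).symm (m ⊗ₜ[k] y))) =
        (TensorProduct.assoc k M N (A ⊗[k] A)).symm
          (m ⊗ₜ[k] TensorProduct.assoc k N A A y) := by
      induction y with
      | zero => simp
      | add x y hx hy => simp only [tmul_add, map_add, hx, hy]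
      | tmul x y =>
        induction x with
        | zero => simp
        | add x y hx hy => simp only [tmul_add, add_tmul, map_add, hx, hy]
        | tmul x y => simp
    rw [er, h, h', h'', (hT n).rcoact_coassoc]
  · have h (y : N ⊗[k] A) : TensorProduct.assoc k A (M ⊗[k] N) A
        ((S.boxTwo T).lcoact.rTensor A ((TensorProduct.assoc k M N A).symm (m ⊗ₜ[k] y))) =
        (TensorProduct.assoc k M N A).symm.toLinearMap.lTensor A
          (TensorProduct.assoc k A M (N ⊗[k] A) (S.lcoact m ⊗ₜ[k] y)) := by
      induction y with
      | zero => simp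
      | add x y hx hy => simp only [tmul_add, map_add, hx, hy]
      | tmul x y =>
        rw [TensorProduct.assoc_symm_tmul, LinearMap.rTensor_tmul, el]
        generalize S.lcoact m = z
        induction z with
        | zero => simp
        | add x y hx hy => simp only [add_tmul, map_add, hx, hy]
        | tmul x y => simp
    have h' (x : A ⊗[k] M) : (S.boxTwo T).rcoact.lTensor A
        (TensorProduct.assoc k A M N (x ⊗ₜ[k] n)) =
        (TensorProduct.assoc k M N A).symm.toLinearMap.lTensor A
          (TensorProduct.assoc k A M (N ⊗[k] A) (x ⊗ₜ[k] T.rcoact n)) := by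
      induction x with
      | zero => simp
      | add x y hx hy => simp only [add_tmul, map_add, hx, hy]
      | tmul x y => simp
    rw [er, el, h, h']
  · intro a
    have h₁ : S.lcoact.rTensor N (map₂ S.lact T.lact (Coalgebra.comul (R := k) a) (m ⊗ₜ[k] n)) =
        map₂ (map₂ (LinearMap.mul k A) S.lact) T.lact
          ((Coalgebra.comul (R := k) (A := A)).rTensor A (Coalgebra.comul (R := k) a))
          (S.lcoact.rTensor N (m ⊗ₜ[k] n)) :=
      map_map₂_tetra (fun a m => (hS m).lcoact_lact a) (by simp) _ _
    have h₂ (z) : map₂ (LinearMap.mul k A) (S.boxTwo T).lact (Coalgebra.comul (R := k) a) z =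
        map₂ (LinearMap.mul k A) (map₂ S.lact T.lact)
          ((Coalgebra.comul (R := k) (A := A)).lTensor A (Coalgebra.comul (R := k) a)) z := by
      simpa [LinearMap.lTensor] using map_map₂_tetra (k := k) (p := LinearMap.mul k A)
        (q := (S.boxTwo T).lact) (p' := LinearMap.mul k A) (q' := map₂ S.lact T.lact)
        (f := LinearMap.id) (g := LinearMap.id) (f₁ := LinearMap.id) (f₂ := LinearMap.id)
        (g₁ := Coalgebra.comul) (g₂ := LinearMap.id) (by simp) (by simp)
        (Coalgebra.comul (R := k) a) z
    rw [h₂, el, ← Coalgebra.coassoc_apply]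
    simp only [boxTwo_lact, boxTwo_lcoact, LinearMap.comp_apply, LinearEquiv.coe_coe]
    rw [h₁, assoc_map₂_tetra, LinearMap.rTensor_tmul]
  · intro a
    have h₁ : S.lcoact.rTensor N (map₂ S.ract T.ract (Coalgebra.comul (R := k) a) (m ⊗ₜ[k] n)) =
        map₂ (map₂ (LinearMap.mul k A).flip S.ract) T.ract
          ((Coalgebra.comul (R := k) (A := A)).rTensor A (Coalgebra.comul (R := k) a))
          (S.lcoact.rTensor N (m ⊗ₜ[k] n)) :=
      map_map₂_tetra (fun a m => (hS m).lcoact_ract a) (by simp) _ _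
    have h₂ (z) : map₂ (LinearMap.mul k A).flip (S.boxTwo T).ract (Coalgebra.comul (R := k) a) z =
        map₂ (LinearMap.mul k A).flip (map₂ S.ract T.ract)
          ((Coalgebra.comul (R := k) (A := A)).lTensor A (Coalgebra.comul (R := k) a)) z := by
      simpa [LinearMap.lTensor] using map_map₂_tetra (k := k) (p := (LinearMap.mul k A).flip)
        (q := (S.boxTwo T).ract) (p' := (LinearMap.mul k A).flip) (q' := map₂ S.ract T.ract)
        (f := LinearMap.id) (g := LinearMap.id) (f₁ := LinearMap.id) (f₂ := LinearMap.id)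
        (g₁ := Coalgebra.comul) (g₂ := LinearMap.id) (by simp) (by simp)
        (Coalgebra.comul (R := k) a) z
    rw [h₂, el, ← Coalgebra.coassoc_apply]
    simp only [boxTwo_ract, boxTwo_lcoact, LinearMap.comp_apply, LinearEquiv.coe_coe]
    rw [h₁, assoc_map₂_tetra, LinearMap.rTensor_tmul]
  · intro a
    have h₁ : T.rcoact.lTensor M (map₂ S.lact T.lact (Coalgebra.comul (R := k) a) (m ⊗ₜ[k] n)) =
        map₂ S.lact (map₂ T.lact (LinearMap.mul k A))
          ((Coalgebra.comul (R := k) (A := A)).lTensor A (Coalgebra.comul (R := k) a))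
          (T.rcoact.lTensor M (m ⊗ₜ[k] n)) :=
      map_map₂_tetra (by simp) (fun a n => (hT n).rcoact_lact a) _ _
    have h₂ (z) : map₂ (S.boxTwo T).lact (LinearMap.mul k A) (Coalgebra.comul (R := k) a) z =
        map₂ (map₂ S.lact T.lact) (LinearMap.mul k A)
          ((Coalgebra.comul (R := k) (A := A)).rTensor A (Coalgebra.comul (R := k) a)) z := by
      simpa [LinearMap.rTensor] using map_map₂_tetra (k := k) (q := LinearMap.mul k A)
        (p := (S.boxTwo T).lact) (q' := LinearMap.mul k A) (p' := map₂ S.lact T.lact)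
        (f := LinearMap.id) (g := LinearMap.id) (g₁ := LinearMap.id) (f₂ := LinearMap.id)
        (f₁ := Coalgebra.comul) (g₂ := LinearMap.id) (by simp) (by simp)
        (Coalgebra.comul (R := k) a) z
    rw [h₂, er, ← Coalgebra.coassoc_symm_apply]
    simp only [boxTwo_lact, boxTwo_rcoact, LinearMap.comp_apply, LinearEquiv.coe_coe]
    rw [h₁, assoc_symm_map₂_tetra, LinearMap.lTensor_tmul]
  · intro a
    have h₁ : T.rcoact.lTensor M (map₂ S.ract T.ract (Coalgebra.comul (R := k) a) (m ⊗ₜ[k] n)) =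
        map₂ S.ract (map₂ T.ract (LinearMap.mul k A).flip)
          ((Coalgebra.comul (R := k) (A := A)).lTensor A (Coalgebra.comul (R := k) a))
          (T.rcoact.lTensor M (m ⊗ₜ[k] n)) :=
      map_map₂_tetra (by simp) (fun a n => (hT n).rcoact_ract a) _ _
    have h₂ (z) : map₂ (S.boxTwo T).ract (LinearMap.mul k A).flip (Coalgebra.comul (R := k) a) z =
        map₂ (map₂ S.ract T.ract) (LinearMap.mul k A).flip
          ((Coalgebra.comul (R := k) (A := A)).rTensor A (Coalgebra.comul (R := k) a)) z := by
      simpa [LinearMap.rTensor] using map_map₂_tetra (k := k) (q := (LinearMap.mul k A).flip)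
        (p := (S.boxTwo T).ract) (q' := (LinearMap.mul k A).flip) (p' := map₂ S.ract T.ract)
        (f := LinearMap.id) (g := LinearMap.id) (g₁ := LinearMap.id) (f₂ := LinearMap.id)
        (f₁ := Coalgebra.comul) (g₂ := LinearMap.id) (by simp) (by simp)
        (Coalgebra.comul (R := k) a) z
    rw [h₂, er, ← Coalgebra.coassoc_symm_apply]
    simp only [boxTwo_ract, boxTwo_rcoact, LinearMap.comp_apply, LinearEquiv.coe_coe]
    rw [h₁, assoc_symm_map₂_tetra, LinearMap.lTensor_tmul]

/-- The external products are functorial in the second argument. -/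
lemma boxOne_lTensor_mem (S : TetraStr k A M) {T : TetraStr k A N} {U : TetraStr k A P}
    {f : N →ₗ[k] P} (hf : f ∈ homs T U) : f.lTensor M ∈ homs (S.boxOne T) (S.boxOne U) := by
  refine ⟨fun a z => ?_, fun a z => ?_, fun z => ?_, fun z => ?_⟩ <;> induction z with
    | zero => simp
    | add x y hx hy => simp only [map_add, hx, hy]
    | tmul m n => ?_
  · simp
  · simp [hf.2.1]
  · have := map_map₂_tetra (k := k) (p := LinearMap.mul k A) (q := TensorProduct.mk k M N)
      (p' := LinearMap.mul k A) (q' := TensorProduct.mk k M P) (f := LinearMap.id)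
      (g := f.lTensor M) (f₁ := LinearMap.id) (f₂ := LinearMap.id) (g₁ := LinearMap.id) (g₂ := f)
      (by simp) (by simp) (S.lcoact m) (T.lcoact n)
    simp only [TensorProduct.map_id, LinearMap.id_apply] at this
    simp only [boxOne_lcoact, LinearMap.lTensor_tmul, TensorProduct.lift.tmul,
      LinearMap.compl₁₂_apply, hf.2.2.1]
    exact this.symm
  · have := map_map₂_tetra (k := k) (q := LinearMap.mul k A) (p := TensorProduct.mk k M N)
      (q' := LinearMap.mul k A) (p' := TensorProduct.mk k M P) (g := LinearMap.id)
      (f := f.lTensor M) (f₁ := LinearMap.id) (g₁ := LinearMap.id) (g₂ := LinearMap.id) (f₂ := f)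
      (by simp) (by simp) (S.rcoact m) (T.rcoact n)
    simp only [TensorProduct.map_id, LinearMap.id_apply] at this
    simp only [boxOne_rcoact, LinearMap.lTensor_tmul, TensorProduct.lift.tmul,
      LinearMap.compl₁₂_apply, hf.2.2.2]
    exact this.symm

lemma boxTwo_lTensor_mem (S : TetraStr k A M) {T : TetraStr k A N} {U : TetraStr k A P}
    {f : N →ₗ[k] P} (hf : f ∈ homs T U) : f.lTensor M ∈ homs (S.boxTwo T) (S.boxTwo U) := by
  refine ⟨fun a z => ?_, fun a z => ?_, fun z => ?_, fun z => ?_⟩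
  · have := map_map₂_tetra (k := k) (p := S.lact) (q := T.lact)
      (p' := S.lact) (q' := U.lact) (f := LinearMap.id)
      (g := f) (f₁ := LinearMap.id) (f₂ := LinearMap.id) (g₁ := LinearMap.id) (g₂ := f)
      (by simp) hf.1 (Coalgebra.comul (R := k) a) z
    simp only [TensorProduct.map_id, LinearMap.id_apply] at this
    exact this
  · have := map_map₂_tetra (k := k) (p := S.ract) (q := T.ract)
      (p' := S.ract) (q' := U.ract) (f := LinearMap.id)
      (g := f) (f₁ := LinearMap.id) (f₂ := LinearMap.id) (g₁ := LinearMap.id) (g₂ := f)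
      (by simp) hf.2.1 (Coalgebra.comul (R := k) a) z
    simp only [TensorProduct.map_id, LinearMap.id_apply] at this
    exact this
  · induction z with
    | zero => simp
    | add x y hx hy => simp only [map_add, hx, hy]
    | tmul m n =>
      simp only [boxTwo_lcoact, LinearMap.lTensor_tmul, LinearMap.comp_apply,
        LinearMap.rTensor_tmul, LinearEquiv.coe_coe]
      generalize S.lcoact m = z
      induction z with
      | zero => simp
      | add x y hx hy => simp only [map_add, add_tmul, hx, hy]
      | tmul a b => simp
  · induction z with
    | zero => simp
    | add x y hx hy => simp only [map_add, hx, hy]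
    | tmul m n =>
      simp only [boxTwo_rcoact, LinearMap.lTensor_tmul, LinearMap.comp_apply,
        LinearEquiv.coe_coe, hf.2.2.2]
      generalize T.rcoact n = z
      induction z with
      | zero => simp
      | add x y hx hy => simp only [map_add, tmul_add, hx, hy]
      | tmul a b => simp

/-- The left action is a morphism of tetramodules `A ⊠₁ M ⟶ M`. -/
lemma lift_lact_mem (hS : ∀ m, S.LawfulAt m) :
    TensorProduct.lift S.lact ∈ homs ((self k A).boxOne S) S := by
  refine ⟨fun a z => ?_, fun a z => ?_, fun z => ?_, fun z => ?_⟩ <;> induction z with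
    | zero => simp
    | add x y hx hy => simp only [map_add, hx, hy]
    | tmul b m => ?_
  · simp [(hS m).mul_lact]
  · simp [(hS m).lact_ract]
  · have := map_map₂_tetra (k := k) (p := LinearMap.mul k A) (q := TensorProduct.mk k A M)
      (p' := LinearMap.mul k A) (q' := S.lact) (f := LinearMap.id)
      (g := TensorProduct.lift S.lact) (f₁ := LinearMap.id) (f₂ := LinearMap.id)
      (g₁ := LinearMap.id) (g₂ := LinearMap.id)
      (by simp) (by simp) (Coalgebra.comul (R := k) b) (S.lcoact m)
    simp only [TensorProduct.map_id, LinearMap.id_apply] at this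
    simpa [(hS m).lcoact_lact, LinearMap.lTensor] using this.symm
  · have := map_map₂_tetra (k := k) (q := LinearMap.mul k A) (p := TensorProduct.mk k A M)
      (q' := LinearMap.mul k A) (p' := S.lact) (g := LinearMap.id)
      (f := TensorProduct.lift S.lact) (f₁ := LinearMap.id) (f₂ := LinearMap.id)
      (g₁ := LinearMap.id) (g₂ := LinearMap.id)
      (by simp) (by simp) (Coalgebra.comul (R := k) b) (S.rcoact m)
    simp only [TensorProduct.map_id, LinearMap.id_apply] at this
    simpa [(hS m).rcoact_lact, LinearMap.rTensor] using this.symm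

/-- The left coaction is a morphism of tetramodules `M ⟶ A ⊠₂ M`. -/
lemma lcoact_mem (hS : ∀ m, S.LawfulAt m) : S.lcoact ∈ homs S ((self k A).boxTwo S) := by
  refine ⟨fun a m => ?_, fun a m => ?_, fun m => ?_, fun m => ?_⟩
  · simp [(hS m).lcoact_lact]
  · simp [(hS m).lcoact_ract]
  · simp [(hS m).lcoact_coassoc]
  · simp [← (hS m).lcoact_rcoact]

end Box

end TetraStr

/-- A tetramodule over the bialgebra `A`. -/
structure Tetra (k : Type v) (A : Type u) [Field k] [Ring A] [Bialgebra k A] where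
  carrier : Type u
  [addCommGroup : AddCommGroup carrier]
  [module : Module k carrier]
  str : TetraStr k A carrier
  lawful : ∀ m, str.LawfulAt m

namespace Tetra

open TensorProduct

attribute [instance] addCommGroup module

variable {k : Type v} {A : Type u} [Field k] [Ring A] [Bialgebra k A]

/-- The category `Tetra(A)` of tetramodules. -/
instance : Category.{u} (Tetra k A) where
  Hom M N := TetraStr.homs M.str N.str
  id M := ⟨LinearMap.id, TetraStr.id_mem⟩
  comp f g := ⟨g.1 ∘ₗ f.1, TetraStr.comp_mem f.2 g.2⟩

variable {M N P : Tetra k A}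

/-- The underlying linear map of a morphism of tetramodules. -/
def lin (f : M ⟶ N) : M.carrier →ₗ[k] N.carrier := Subtype.val f

/-- Constructor for morphisms of tetramodules. -/
def homMk (f : M.carrier →ₗ[k] N.carrier) (hf : f ∈ TetraStr.homs M.str N.str) : M ⟶ N :=
  ⟨f, hf⟩

lemma lin_mem (f : M ⟶ N) : lin f ∈ TetraStr.homs M.str N.str := Subtype.property f

@[simp] lemma lin_homMk (f : M.carrier →ₗ[k] N.carrier) (hf) : lin (homMk f hf) = f := rfl

@[ext] lemma hom_ext {f g : M ⟶ N} (h : lin f = lin g) : f = g := Subtype.ext h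

@[simp] lemma lin_id : lin (𝟙 M) = LinearMap.id := rfl

@[simp] lemma lin_comp (f : M ⟶ N) (g : N ⟶ P) : lin (f ≫ g) = lin g ∘ₗ lin f := rfl

instance (M N : Tetra k A) : AddCommGroup (M ⟶ N) :=
  inferInstanceAs (AddCommGroup (TetraStr.homs M.str N.str))

instance (M N : Tetra k A) : Module k (M ⟶ N) :=
  inferInstanceAs (Module k (TetraStr.homs M.str N.str))

@[simp] lemma lin_add (f g : M ⟶ N) : lin (f + g) = lin f + lin g := rfl

@[simp] lemma lin_sub (f g : M ⟶ N) : lin (f - g) = lin f - lin g := rfl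

@[simp] lemma lin_smul (c : k) (f : M ⟶ N) : lin (c • f) = c • lin f := rfl

@[simp] lemma lin_zero' : lin (0 : M ⟶ N) = 0 := rfl

instance : Preadditive (Tetra k A) where
  add_comp _ _ _ f f' g := by ext : 1; simp [LinearMap.comp_add]
  comp_add _ _ _ f g g' := by ext : 1; simp [LinearMap.add_comp]

@[simp] lemma lin_zero : lin (0 : M ⟶ N) = 0 := rfl

instance : Linear k (Tetra k A) where
  smul_comp _ _ _ r f g := by ext : 1; simp [LinearMap.comp_smul]
  comp_smul _ _ _ f r g := by ext : 1; simp [LinearMap.smul_comp]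

section Abelian

variable (f : M ⟶ N)

/-- The kernel of a morphism of tetramodules. -/
def ker : Tetra k A where
  carrier := LinearMap.ker (lin f)
  str := (TetraStr.exists_ker (lin_mem f)).choose
  lawful _ := TetraStr.LawfulAt.of_map (TetraStr.exists_ker (lin_mem f)).choose_spec
    (Submodule.injective_subtype _) (M.lawful _)

/-- The inclusion of the kernel. -/
def kerι : ker f ⟶ M :=
  homMk (LinearMap.ker (lin f)).subtype (TetraStr.exists_ker (lin_mem f)).choose_spec

/-- The cokernel of a morphism of tetramodules. -/
def coker : Tetra k A where
  carrier := N.carrier ⧸ LinearMap.range (lin f)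
  str := (TetraStr.exists_coker (lin_mem f)).choose
  lawful m := by
    obtain ⟨n, rfl⟩ := Submodule.mkQ_surjective _ m
    exact TetraStr.LawfulAt.map (TetraStr.exists_coker (lin_mem f)).choose_spec (N.lawful n)

/-- The projection to the cokernel. -/
def cokerπ : N ⟶ coker f :=
  homMk (LinearMap.range (lin f)).mkQ (TetraStr.exists_coker (lin_mem f)).choose_spec

lemma kerι_comp : kerι f ≫ f = 0 := by
  ext x
  exact x.2

lemma comp_cokerπ : f ≫ cokerπ f = 0 := by
  ext x
  exact (Submodule.Quotient.mk_eq_zero _).2 ⟨x, rfl⟩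

/-- An injective morphism is a kernel of every morphism with kernel its image. -/
def isLimitOfExact (g : N ⟶ P) (w : f ≫ g = 0) (hi : Function.Injective (lin f))
    (h : LinearMap.ker (lin g) ≤ LinearMap.range (lin f)) :
    IsLimit (KernelFork.ofι f w) := by
  have : Mono f := ⟨fun a b hab => by
    ext x
    exact hi (LinearMap.congr_fun (congrArg lin hab) x)⟩
  refine KernelFork.IsLimit.ofι' f w fun {X} a ha => ?_
  have ha' : ∀ x, lin a x ∈ LinearMap.range (lin f) := fun x =>
    h (LinearMap.congr_fun (congrArg lin ha) x)
  let e := LinearEquiv.ofInjective (lin f) hi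
  let b : X.carrier →ₗ[k] M.carrier := e.symm.toLinearMap ∘ₗ (lin a).codRestrict _ ha'
  have hb : lin f ∘ₗ b = lin a := by
    ext x
    exact congrArg Subtype.val (e.apply_symm_apply ⟨lin a x, ha' x⟩)
  exact ⟨homMk b (TetraStr.mem_of_comp_mem_left (lin_mem f) hi (hb ▸ lin_mem a)),
    hom_ext hb⟩

/-- A surjective morphism is a cokernel of every morphism with image its kernel. -/
def isColimitOfExact (g : N ⟶ P) (w : f ≫ g = 0) (hs : Function.Surjective (lin g))
    (h : LinearMap.ker (lin g) ≤ LinearMap.range (lin f)) :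
    IsColimit (CokernelCofork.ofπ g w) := by
  have : Epi g := ⟨fun a b hab => by
    ext x
    obtain ⟨y, rfl⟩ := hs x
    exact LinearMap.congr_fun (congrArg lin hab) y⟩
  refine CokernelCofork.IsColimit.ofπ' g w fun {X} a ha => ?_
  have ha' : LinearMap.ker (lin g) ≤ LinearMap.ker (lin a) := fun y hy => by
    obtain ⟨z, rfl⟩ := h hy
    exact LinearMap.congr_fun (congrArg lin ha) z
  let e := (lin g).quotKerEquivOfSurjective hs
  let b : P.carrier →ₗ[k] X.carrier := (LinearMap.ker (lin g)).liftQ (lin a) ha' ∘ₗ e.symm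
  have hb : b ∘ₗ lin g = lin a := by
    ext x
    have : e.symm (lin g x) = Submodule.Quotient.mk x := by
      rw [LinearEquiv.symm_apply_eq]; rfl
    simp [b, this]
  exact ⟨homMk b (TetraStr.mem_of_comp_mem_right (lin_mem g) hs (hb ▸ lin_mem a)),
    hom_ext hb⟩

lemma injective_of_mono [Mono f] : Function.Injective (lin f) := by
  have h : kerι f = 0 := by rw [← cancel_mono f, kerι_comp, zero_comp]
  rw [← LinearMap.ker_eq_bot, Submodule.eq_bot_iff]
  exact fun x hx => LinearMap.congr_fun (congrArg lin h) ⟨x, hx⟩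

lemma surjective_of_epi [Epi f] : Function.Surjective (lin f) := by
  have h : cokerπ f = 0 := by rw [← cancel_epi f, comp_cokerπ, comp_zero]
  intro x
  exact (Submodule.Quotient.mk_eq_zero _).1 (LinearMap.congr_fun (congrArg lin h) x)

instance : HasKernels (Tetra k A) where
  has_limit f := HasLimit.mk ⟨_, isLimitOfExact (kerι f) f (kerι_comp f)
    (Submodule.injective_subtype _) (Submodule.range_subtype _).ge⟩

instance : HasCokernels (Tetra k A) where
  has_colimit f := HasColimit.mk ⟨_, isColimitOfExact f (cokerπ f) (comp_cokerπ f)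
    (Submodule.mkQ_surjective _) (Submodule.ker_mkQ _).le⟩

/-- The direct sum of two tetramodules. -/
def prod (M N : Tetra k A) : Tetra k A where
  carrier := M.carrier × N.carrier
  str := M.str.prod N.str
  lawful z := by
    have : z = LinearMap.inl k _ _ z.1 + LinearMap.inr k _ _ z.2 := by simp
    rw [this]
    exact (TetraStr.LawfulAt.map (TetraStr.inl_mem _ _) (M.lawful _)).add
      (TetraStr.LawfulAt.map (TetraStr.inr_mem _ _) (N.lawful _))

instance : HasBinaryBiproducts (Tetra k A) where
  has_binary_biproduct M N := hasBinaryBiproduct_of_total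
    { pt := prod M N
      fst := homMk (N := M) (LinearMap.fst k _ _) (TetraStr.fst_mem M.str N.str)
      snd := homMk (N := N) (LinearMap.snd k _ _) (TetraStr.snd_mem M.str N.str)
      inl := homMk (M := M) (LinearMap.inl k _ _) (TetraStr.inl_mem M.str N.str)
      inr := homMk (M := N) (LinearMap.inr k _ _) (TetraStr.inr_mem M.str N.str)
      inl_fst := hom_ext (by ext x; rfl)
      inl_snd := hom_ext (by ext x; rfl)
      inr_fst := hom_ext (by ext x; rfl)
      inr_snd := hom_ext (by ext x; rfl) }
    (hom_ext (by
      refine LinearMap.ext fun z => ?_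
      change (z.1, (0 : N.carrier)) + ((0 : M.carrier), z.2) = z
      rw [Prod.mk_add_mk, add_zero, zero_add]
      rfl))

/-- The zero tetramodule. -/
def zero (k : Type v) (A : Type u) [Field k] [Ring A] [Bialgebra k A] : Tetra k A where
  carrier := PUnit
  str := ⟨0, 0, 0, 0⟩
  lawful m := by
    obtain rfl : m = 0 := Subsingleton.elim _ _
    exact .zero

instance : HasZeroObject (Tetra k A) where
  zero := ⟨zero k A, by
    rw [IsZero.iff_id_eq_zero]
    ext x
    exact Subsingleton.elim (α := PUnit) _ _⟩

instance : Abelian (Tetra k A) where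
  normalMonoOfMono f _ := ⟨⟨coker f, cokerπ f, comp_cokerπ f,
    isLimitOfExact f (cokerπ f) (comp_cokerπ f) (injective_of_mono f)
      (Submodule.ker_mkQ _).le⟩⟩
  normalEpiOfEpi f _ := ⟨⟨ker f, kerι f, kerι_comp f,
    isColimitOfExact (kerι f) f (kerι_comp f) (surjective_of_epi f)
      (Submodule.range_subtype _).ge⟩⟩
  has_finite_products := hasFiniteProducts_of_has_binary_and_terminal

/-- The `Ext`-groups of `Tetra(A)` are taken in a universe in which they always exist. -/
instance : HasExt.{max v (u + 1)} (Tetra k A) := HasExt.standard _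

end Abelian

variable (k A) in
/-- The tautological tetramodule `A`. -/
def self : Tetra k A where
  carrier := A
  str := TetraStr.self k A
  lawful := TetraStr.self_lawful

/-- The first external product `M ⊠₁ N`, with underlying vector space `M ⊗ N`. -/
def boxOne (M N : Tetra k A) : Tetra k A where
  carrier := M.carrier ⊗[k] N.carrier
  str := M.str.boxOne N.str
  lawful := TetraStr.boxOne_lawful M.lawful N.lawful

/-- The second external product `M ⊠₂ N`, with underlying vector space `M ⊗ N`. -/
def boxTwo (M N : Tetra k A) : Tetra k A where
  carrier := M.carrier ⊗[k] N.carrier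
  str := M.str.boxTwo N.str
  lawful := TetraStr.boxTwo_lawful M.lawful N.lawful

/-- The morphism `id ⊗ f : M ⊠₁ N ⟶ M ⊠₁ P`. -/
def boxOneLeft (M : Tetra k A) (f : N ⟶ P) : M.boxOne N ⟶ M.boxOne P :=
  homMk ((lin f).lTensor M.carrier) (TetraStr.boxOne_lTensor_mem M.str (lin_mem f))

/-- The morphism `id ⊗ f : M ⊠₂ N ⟶ M ⊠₂ P`. -/
def boxTwoLeft (M : Tetra k A) (f : N ⟶ P) : M.boxTwo N ⟶ M.boxTwo P :=
  homMk ((lin f).lTensor M.carrier) (TetraStr.boxTwo_lTensor_mem M.str (lin_mem f))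

/-- The left action as a morphism of tetramodules `A ⊠₁ M ⟶ M`, `a ⊗ m ↦ a * m`. -/
def act (M : Tetra k A) : (self k A).boxOne M ⟶ M :=
  homMk (TensorProduct.lift M.str.lact) (TetraStr.lift_lact_mem M.lawful)

/-- The left coaction as a morphism of tetramodules `M ⟶ A ⊠₂ M`. -/
def coact (M : Tetra k A) : M ⟶ (self k A).boxTwo M :=
  homMk M.str.lcoact (TetraStr.lcoact_mem M.lawful)

lemma act_naturality (f : M ⟶ N) : act M ≫ f = boxOneLeft (self k A) f ≫ act N := by
  ext : 1
  exact TensorProduct.ext' fun a m => (lin_mem f).1 a m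

lemma coact_naturality (f : M ⟶ N) : f ≫ coact N = coact M ≫ boxTwoLeft (self k A) f := by
  ext m
  exact (lin_mem f).2.2.1 m

lemma boxOneLeft_comp {Q : Tetra k A} (M : Tetra k A) (f : N ⟶ P) (g : P ⟶ Q) :
    boxOneLeft M (f ≫ g) = boxOneLeft M f ≫ boxOneLeft M g :=
  hom_ext (LinearMap.lTensor_comp _ _ _)

lemma boxTwoLeft_comp {Q : Tetra k A} (M : Tetra k A) (f : N ⟶ P) (g : P ⟶ Q) :
    boxTwoLeft M (f ≫ g) = boxTwoLeft M f ≫ boxTwoLeft M g :=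
  hom_ext (LinearMap.lTensor_comp _ _ _)

@[simp] lemma boxOneLeft_zero (M : Tetra k A) : boxOneLeft M (0 : N ⟶ P) = 0 :=
  hom_ext (LinearMap.lTensor_zero _)

@[simp] lemma boxTwoLeft_zero (M : Tetra k A) : boxTwoLeft M (0 : N ⟶ P) = 0 :=
  hom_ext (LinearMap.lTensor_zero _)

section Bar

variable (k A)

/-- `barObj k A n = A ⊠₁ (A ⊠₁ (⋯ ⊠₁ A))`, with `n + 1` factors `A`. -/
def barObj : ℕ → Tetra k A
  | 0 => self k A
  | n + 1 => (self k A).boxOne (barObj n)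

end Bar

/-- The step `d ↦ (left action) - id ⊗ d` from `A ⊠₁ N ⟶ N` to
`A ⊠₁ (A ⊠₁ N) ⟶ A ⊠₁ N`. -/
def barStep (d : (self k A).boxOne N ⟶ N) :
    (self k A).boxOne ((self k A).boxOne N) ⟶ (self k A).boxOne N :=
  act ((self k A).boxOne N) - boxOneLeft (self k A) d

/-- The step `d ↦ (left coaction) - id ⊗ d` from `N ⟶ A ⊠₂ N` to
`A ⊠₂ N ⟶ A ⊠₂ (A ⊠₂ N)`. -/
def cobarStep (d : N ⟶ (self k A).boxTwo N) :
    (self k A).boxTwo N ⟶ (self k A).boxTwo ((self k A).boxTwo N) :=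
  coact ((self k A).boxTwo N) - boxTwoLeft (self k A) d

lemma barStep_act : barStep (act N) ≫ act N = 0 := by
  rw [barStep, Preadditive.sub_comp, sub_eq_zero]
  exact act_naturality _

lemma cobarStep_coact : coact N ≫ cobarStep (coact N) = 0 := by
  rw [cobarStep, Preadditive.comp_sub, sub_eq_zero]
  exact coact_naturality _

lemma barStep_barStep (d : (self k A).boxOne N ⟶ N) (h : barStep d ≫ d = 0) :
    barStep (barStep d) ≫ barStep d = 0 := by
  have e : barStep d = act ((self k A).boxOne N) - boxOneLeft (self k A) d := rfl
  rw [barStep, Preadditive.sub_comp, act_naturality, ← Preadditive.comp_sub]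
  nth_rewrite 2 [e]
  rw [sub_sub_cancel, ← boxOneLeft_comp, h, boxOneLeft_zero]

lemma cobarStep_cobarStep (d : N ⟶ (self k A).boxTwo N) (h : d ≫ cobarStep d = 0) :
    cobarStep d ≫ cobarStep (cobarStep d) = 0 := by
  have e : cobarStep d = coact ((self k A).boxTwo N) - boxTwoLeft (self k A) d := rfl
  have e' : cobarStep (cobarStep d) = coact ((self k A).boxTwo ((self k A).boxTwo N)) -
    boxTwoLeft (self k A) (cobarStep d) := rfl
  rw [e', Preadditive.comp_sub, coact_naturality, ← Preadditive.sub_comp]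
  nth_rewrite 1 [e]
  rw [sub_sub_cancel, ← boxTwoLeft_comp, h, boxTwoLeft_zero]

section Bar

variable (k A)

/-- The bar differential
`a₀ ⊗ ⋯ ⊗ aₙ₊₁ ↦ ∑ i ≤ n, (-1) ^ i a₀ ⊗ ⋯ ⊗ aᵢ * aᵢ₊₁ ⊗ ⋯ ⊗ aₙ₊₁`, by recursion on `n`: the
term `i = 0` is the left action on the last `n + 1` factors, and the sum of the other terms is
`- id ⊗ d`. -/
def barD : ∀ n, barObj k A (n + 1) ⟶ barObj k A n
  | 0 => act (self k A)
  | n + 1 => barStep (barD n)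

/-- `cobarObj k A n = A ⊠₂ (A ⊠₂ (⋯ ⊠₂ A))`, with `n + 1` factors `A`. -/
def cobarObj : ℕ → Tetra k A
  | 0 => self k A
  | n + 1 => (self k A).boxTwo (cobarObj n)

/-- The cobar differential
`a₀ ⊗ ⋯ ⊗ aₙ ↦ ∑ i ≤ n, (-1) ^ i a₀ ⊗ ⋯ ⊗ Δ(aᵢ) ⊗ ⋯ ⊗ aₙ`, by recursion on `n`: the term
`i = 0` is the left coaction, and the sum of the other terms is `- id ⊗ d`. -/
def cobarD : ∀ n, cobarObj k A n ⟶ cobarObj k A (n + 1)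
  | 0 => coact (self k A)
  | n + 1 => cobarStep (cobarD n)

lemma barD_comp_barD : ∀ n, barD k A (n + 1) ≫ barD k A n = 0
  | 0 => barStep_act
  | n + 1 => barStep_barStep (barD k A n) (barD_comp_barD n)

lemma cobarD_comp_cobarD : ∀ n, cobarD k A n ≫ cobarD k A (n + 1) = 0
  | 0 => cobarStep_coact
  | n + 1 => cobarStep_cobarStep (cobarD k A n) (cobarD_comp_cobarD n)

/-- The truncated bar complex `⋯ → A ⊠₁ A ⊠₁ A → A ⊠₁ A → 0`, with `A ⊠₁ A` in degree `0`. -/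
def bar : ChainComplex (Tetra k A) ℕ :=
  ChainComplex.of (fun n => barObj k A (n + 1)) (fun n => barD k A (n + 1))
    (fun n => barD_comp_barD k A (n + 1))

/-- The truncated cobar complex `0 → A ⊠₂ A → A ⊠₂ A ⊠₂ A → ⋯`, with `A ⊠₂ A` in degree `0`. -/
def cobar : CochainComplex (Tetra k A) ℕ :=
  CochainComplex.of (fun n => cobarObj k A (n + 1)) (fun n => cobarD k A (n + 1))
    (fun n => cobarD_comp_cobarD k A (n + 1))

end Bar

end Tetra

open CochainComplex.HomComplex in
/-- The total complex of morphisms between two cochain complexes in a `k`-linear category, as a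
complex of `k`-vector spaces: in degree `n` it is the space `∏ p, (K.X p ⟶ L.X (p + n))`, with
differential `z ↦ z ≫ d_L + (-1) ^ (n + 1) d_K ≫ z`. -/
def linearHomComplex (k : Type v) [Field k] {C : Type*} [Category.{u} C] [Preadditive C]
    [Linear k C] (K L : CochainComplex C ℤ) : CochainComplex (ModuleCat.{u} k) ℤ where
  X n := ModuleCat.of k (Cochain K L n)
  d n m := ModuleCat.ofHom (δ_hom k K L n m)
  shape n m h := by
    refine ModuleCat.hom_ext (LinearMap.ext fun z => ?_)
    exact δ_shape n m h z
  d_comp_d' n m p _ _ := by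
    refine ModuleCat.hom_ext (LinearMap.ext fun z => ?_)
    exact δ_δ n m p z

/-- The Gerstenhaber-Schack complex `Hom_{Tetra(A)}(Bar(A), Cobar(A))` of the bialgebra `A`.
The bar complex is put in degrees `≤ 0` and the cobar complex in degrees `≥ 0`. -/
def gsComplex (k : Type v) (A : Type u) [Field k] [Ring A] [Bialgebra k A] :
    CochainComplex (ModuleCat.{u} k) ℤ :=
  linearHomComplex k ((Tetra.bar k A).extend ComplexShape.embeddingDownNat)
    ((Tetra.cobar k A).extend ComplexShape.embeddingUpNat)

/-- The Gerstenhaber-Schack cohomology `H_GS(A, A)` of the bialgebra `A`. -/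
abbrev gsCohomology (k : Type v) (A : Type u) [Field k] [Ring A] [Bialgebra k A] (n : ℤ) :
    ModuleCat.{u} k :=
  (gsComplex k A).homology n

end

/-!
Write `C` for the category of tetramodules over `A`. For any complexes `P` and `Q` in `C`, with
quasi-isomorphisms `P ⟶ A` and `A ⟶ Q`, and an injective resolution `I` of `A`, there are maps
`Ext(A, A) = H(Hom(A, I)) ⟶ H(Hom(P, I)) ⟵ H(Hom(P, Q))`, where the second one is induced by a
comparison morphism `φ : Q ⟶ I`. The first map is an isomorphism because `I` is K-injective, and
the second one as soon as `Hom(P, cone φ)` is acyclic (`nonempty_ext_linearEquiv_homology`). The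
point is to prove this for the bar complex `P` and the cobar complex `Q`, whose terms are in
general neither projective nor injective in `C`.

They are so in a relative sense. The tetramodule `A ⊠₂ M ⊠₂ A` is the cofree tetramodule on the
bimodule underlying `M`, and `A ⊠₁ M ⊠₁ A` is the free tetramodule on the bicomodule underlying
`M`. Call `M` relatively injective if the coaction `M → A ⊗ M ⊗ A` has a retraction which is a
morphism of bicomodules (not necessarily of bimodules), and relatively projective if the action
`A ⊗ M ⊗ A → M` has a section which is a morphism of tetramodules. Injective tetramodules are
relatively injective, and so are the terms of the cobar complex (`relInjective_cobar`); the terms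
of the bar complex are relatively projective (`relProjective_bar`).

The cone of `φ` is therefore a bounded below acyclic complex of relatively injective tetramodules.
As a complex of bicomodules it is bounded below, exact and has injective terms, so it is contractible
(`exists_splitting_of_acyclic`). Morphisms from a relatively projective tetramodule lift along
surjections of tetramodules which split over bicomodules (`RelProjective.exists_lift`), so
`Hom(barᵖ, cone φ)` is exact for all `p`. Since the bar complex is bounded above and the cone is
bounded below, the total complex is acyclic too (`homAcyclic_of_lift`).

Besides, the category of tetramodules has enough injectives, namely the cofree tetramodules on the
coinduced bimodules `Hom(A ⊗ A, V)`, and the bar and cobar complexes are resolutions of `A`: their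
augmentations are contracted, over `k`, by the unit and the counit of `A`.
-/

/-! ### Homology of complexes of morphisms, and `Ext` -/

noncomputable section

open CochainComplex CochainComplex.HomComplex

/-- A linear map between modules of cycles which detects boundaries and hits every class induces
an isomorphism between the quotients. -/
def Submodule.quotientEquivOfMem {R Z₁ Z₂ : Type*} [Ring R] [AddCommGroup Z₁] [AddCommGroup Z₂]
    [Module R Z₁] [Module R Z₂] {B₁ : Submodule R Z₁} {B₂ : Submodule R Z₂} (f : Z₁ →ₗ[R] Z₂)
    (h : ∀ z, f z ∈ B₂ ↔ z ∈ B₁) (hs : ∀ y, ∃ z, y - f z ∈ B₂) : (Z₁ ⧸ B₁) ≃ₗ[R] (Z₂ ⧸ B₂) :=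
  LinearEquiv.ofBijective (Submodule.mapQ B₁ B₂ f fun z hz => (h z).2 hz) <| by
    constructor
    · rw [← LinearMap.ker_eq_bot, Submodule.eq_bot_iff]
      intro z hz
      obtain ⟨z, rfl⟩ := Submodule.Quotient.mk_surjective _ z
      rw [LinearMap.mem_ker, Submodule.mapQ_apply, Submodule.Quotient.mk_eq_zero, h] at hz
      exact (Submodule.Quotient.mk_eq_zero _).2 hz
    · intro y
      obtain ⟨y, rfl⟩ := Submodule.Quotient.mk_surjective _ y
      obtain ⟨z, hz⟩ := hs y
      exact ⟨Submodule.Quotient.mk z, ((Submodule.Quotient.eq _).2 hz).symm⟩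

section HomComplex

variable (k : Type v) [Field k] {C : Type*} [Category.{u} C] [Preadditive C] [Linear k C]

/-- The coboundaries of degree `n` of the complex of morphisms, as a space over `k`. -/
def linearCoboundaries (K L : CochainComplex C ℤ) (n : ℤ) : Submodule k (Cocycle K L n) where
  __ := coboundaries K L n
  smul_mem' := by
    rintro c z ⟨m, hm, β, hβ⟩
    exact ⟨m, hm, c • β, by rw [δ_smul, hβ, Cocycle.coe_smul]⟩

variable {k} in
lemma mem_linearCoboundaries_iff {K L : CochainComplex C ℤ} {n : ℤ} {z : Cocycle K L n} (m : ℤ)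
    (hm : m + 1 = n) : z ∈ linearCoboundaries k K L n ↔ ∃ β : Cochain K L m, δ m n β = z.1 :=
  mem_coboundaries_iff z m hm

/-- The cohomology of the complex of morphisms is cocycles modulo coboundaries. -/
def linearHomComplexHomologyEquiv (K L : CochainComplex C ℤ) (n : ℤ) :
    (linearHomComplex k K L).homology n ≃ₗ[k] (Cocycle K L n ⧸ linearCoboundaries k K L n) := by
  refine ((linearHomComplex k K L).homologyIsoSc' (n - 1) n (n + 1) (by simp) (by simp) ≪≫
    ShortComplex.moduleCatHomologyIso _).toLinearEquiv ≪≫ₗ ?_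
  let e : LinearMap.ker ((linearHomComplex k K L).d n (n + 1)).hom →ₗ[k] Cocycle K L n :=
    { toFun z := Cocycle.mk z.1 (n + 1) rfl z.2
      map_add' _ _ := rfl
      map_smul' _ _ := rfl }
  refine Submodule.quotientEquivOfMem e (fun z => ?_) (fun y => ⟨⟨y.1, y.δ_eq_zero _⟩, ?_⟩)
  · rw [mem_linearCoboundaries_iff (n - 1) (by simp)]
    constructor
    · rintro ⟨β, hβ⟩
      exact ⟨β, Subtype.ext hβ⟩
    · rintro ⟨β, hβ⟩
      exact ⟨β, congrArg Subtype.val hβ⟩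
  · convert Submodule.zero_mem _
    exact sub_self y

/-- A complex of morphisms has no cohomology. -/
def HomAcyclic (K L : CochainComplex C ℤ) : Prop :=
  ∀ (m n : ℤ), m + 1 = n → ∀ z : Cocycle K L n, ∃ β : Cochain K L m, δ m n β = z.1

section Cone

variable {K L : CochainComplex C ℤ} (f : K ⟶ L) (M : CochainComplex C ℤ)
  [HasBinaryBiproducts C] (n : ℤ)

/-- Precomposition with a morphism of complexes is a quasi-isomorphism on complexes of
morphisms to `M`, if the complex of morphisms from its cone to `M` is acyclic. -/
def precompEquiv (h : HomAcyclic (mappingCone f) M) :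
    (Cocycle L M n ⧸ linearCoboundaries k L M n) ≃ₗ[k]
      (Cocycle K M n ⧸ linearCoboundaries k K M n) :=
  Submodule.quotientEquivOfMem
    { toFun z := z.precomp f
      map_add' _ _ := by ext; simp [Cocycle.precomp]
      map_smul' _ _ := by ext; simp [Cocycle.precomp] }
    (fun z => by
      rw [mem_linearCoboundaries_iff (n - 1) (by simp),
        mem_linearCoboundaries_iff (n - 1) (by simp)]
      constructor
      · rintro ⟨α, hα⟩
        -- A primitive of `z ∘ f` and `z` together form a cocycle on the cone.
        obtain ⟨β, hβ⟩ := h (n - 1) n (by simp)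
          (mappingCone.descCocycle f (n.negOnePow • α) z (by simp)
            (by rw [δ_units_smul, hα]; rfl))
        refine ⟨(Cochain.ofHom (mappingCone.inr f)).comp β (zero_add (n - 1)), ?_⟩
        simp only [δ_ofHom_comp, hβ]
        exact mappingCone.inr_descCochain _ _ _ (by simp)
      · rintro ⟨β, hβ⟩
        refine ⟨(Cochain.ofHom f).comp β (zero_add _), ?_⟩
        simp [Cocycle.precomp, hβ])
    (fun z => by
      obtain ⟨α, hα⟩ := h n (n + 1) rfl (Cocycle.mk ((mappingCone.fst f).1.comp z.1
        (add_comm 1 n)) (n + 1 + 1) rfl (by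
          rw [δ_comp _ _ (add_comm 1 n) 2 (n + 1) _ rfl rfl rfl]; simp))
      have hα : δ n (n + 1) α = (mappingCone.fst f).1.comp z.1 (add_comm 1 n) := hα
      refine ⟨-(n.negOnePow • Cocycle.mk ((Cochain.ofHom (mappingCone.inr f)).comp α (zero_add n))
        (n + 1) rfl ?_), ?_⟩
      · simp [δ_ofHom_comp, hα]
      · rw [mem_linearCoboundaries_iff (n - 1) (by simp)]
        refine ⟨(mappingCone.inl f).comp α (by lia), ?_⟩
        rw [δ_comp _ _ _ 0 (n + 1) n (by lia) rfl rfl]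
        simp [hα, Cocycle.precomp, Cochain.ofHom_comp])

/-- Postcomposition with a morphism of complexes is a quasi-isomorphism on complexes of
morphisms from `M`, if the complex of morphisms from `M` to its cone is acyclic. -/
def postcompEquiv (h : HomAcyclic M (mappingCone f)) :
    (Cocycle M K n ⧸ linearCoboundaries k M K n) ≃ₗ[k]
      (Cocycle M L n ⧸ linearCoboundaries k M L n) :=
  Submodule.quotientEquivOfMem
    { toFun z := z.postcomp f
      map_add' _ _ := by ext; simp [Cocycle.postcomp]
      map_smul' _ _ := by ext; simp [Cocycle.postcomp] }
    (fun z => by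
      rw [mem_linearCoboundaries_iff (n - 1) (by simp),
        mem_linearCoboundaries_iff (n - 1) (by simp)]
      constructor
      · rintro ⟨α, hα⟩
        -- `z` and a primitive of `f ∘ z` together form a cocycle with values in the cone.
        obtain ⟨β, hβ⟩ := h (n - 2) (n - 1) (by lia)
          (mappingCone.liftCocycle f z (-α) (by simp)
            (by rw [δ_neg, hα]; exact neg_add_cancel _))
        refine ⟨-(β.comp (mappingCone.fst f).1 (by lia)), ?_⟩
        rw [δ_neg, δ_comp _ _ _ (n - 1) 2 n (by lia) (by lia) rfl]
        simp [hβ, mappingCone.liftCocycle]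
      · rintro ⟨β, hβ⟩
        refine ⟨β.comp (Cochain.ofHom f) (add_zero _), ?_⟩
        simp [Cocycle.postcomp, hβ])
    (fun z => by
      obtain ⟨α, hα⟩ := h (n - 1) n (by simp) (z.postcomp (mappingCone.inr f))
      have hα : δ (n - 1) n α =
        z.1.comp (Cochain.ofHom (mappingCone.inr f)) (add_zero n) := hα
      refine ⟨Cocycle.mk (α.comp (mappingCone.fst f).1 (by simp)) (n + 1) rfl ?_, ?_⟩
      · rw [δ_comp _ _ _ n 2 (n + 1) (by lia) (by lia) rfl]
        simp [hα]
      · rw [mem_linearCoboundaries_iff (n - 1) (by simp)]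
        refine ⟨α.comp (mappingCone.snd f) (by lia), ?_⟩
        rw [δ_comp _ _ _ n 1 n (by lia) (by lia) rfl]
        simp [hα, Cocycle.postcomp]
        abel)

end Cone

end HomComplex

section Ext

variable (k : Type v) [Field k] {C : Type*} [Category.{u} C] [Abelian C] [Linear k C]
variable {X Y : C} (R : InjectiveResolution Y) (n : ℕ)

universe w

/-- `Ext` is computed, linearly, by an injective resolution. -/
def extLinearEquivOfInjectiveResolution [HasExt.{w} C] :
    (Cocycle ((singleFunctor C 0).obj X) R.cochainComplex n ⧸
      linearCoboundaries k ((singleFunctor C 0).obj X) R.cochainComplex n) ≃ₗ[k]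
    Abelian.Ext X Y n := by
  let f : Cocycle ((singleFunctor C 0).obj X) R.cochainComplex n →ₗ[k] Abelian.Ext X Y n :=
    { toFun z := R.extEquivCohomologyClass.symm (.mk z)
      map_add' x y := by simp
      map_smul' c x := by
        have := HasDerivedCategory.standard C
        ext
        have hx : Cocycle.equivHomShift.symm (c • x) = c • Cocycle.equivHomShift.symm x := by
          obtain ⟨y, rfl⟩ := Cocycle.equivHomShift.surjective x
          rw [AddEquiv.symm_apply_eq, AddEquiv.symm_apply_apply]
          ext p q hpq
          simp [Cocycle.equivHomShift_apply, Cochain.rightUnshift_v _ _ _ _ _ _ _ (add_zero p)]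
          exact (Linear.smul_comp _ _ _ _ _ _).symm
        simp [InjectiveResolution.extEquivCohomologyClass_symm_mk_hom, hx, ShiftedHom.map_smul,
          ShiftedHom.smul_comp, ShiftedHom.comp_smul] }
  refine Submodule.quotEquivOfEq _ _ ?_ ≪≫ₗ f.quotKerEquivOfSurjective fun y => ?_
  · ext z
    rw [LinearMap.mem_ker]
    change _ ↔ R.extEquivCohomologyClass.symm (.mk z) = 0
    rw [Equiv.symm_apply_eq, InjectiveResolution.extEquivCohomologyClass_zero,
      CohomologyClass.mk_eq_zero_iff]
    rfl
  · obtain ⟨z, hz⟩ := CohomologyClass.mk_surjective (R.extEquivCohomologyClass y)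
    exact ⟨z, (Equiv.symm_apply_eq _).2 hz⟩

lemma acyclic_mappingCone {K L : CochainComplex C ℤ} (f : K ⟶ L) [QuasiIso f] :
    (mappingCone f).Acyclic := by
  rw [← HomotopyCategory.quotient_obj_mem_subcategoryAcyclic_iff_acyclic]
  refine ((HomotopyCategory.subcategoryAcyclic C).trW_iff_of_distinguished _
    (HomotopyCategory.mappingCone_triangleh_distinguished f)).1 ?_
  rw [← HomotopyCategory.quasiIso_eq_trW_subcategoryAcyclic]
  exact (HomotopyCategory.quotient_map_mem_quasiIso_iff f).2 ‹QuasiIso f›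

/-- If the complexes of morphisms `P ^ p ⟶ L` are exact, then the total complex of
morphisms `P ⟶ L` is acyclic, for bounded above `P` and bounded below `L`. -/
lemma homAcyclic_of_lift {P L : CochainComplex C ℤ} (a b : ℤ) [P.IsStrictlyLE a]
    [L.IsStrictlyGE b]
    (h : ∀ (p i j l : ℤ), i + 1 = j → j + 1 = l → ∀ g : P.X p ⟶ L.X j, g ≫ L.d j l = 0 →
      ∃ s : P.X p ⟶ L.X i, s ≫ L.d i j = g) : HomAcyclic P L := by
  intro m n hmn z
  -- A primitive is constructed by descending induction on the degree in `P`.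
  have key : ∀ N : ℕ, ∃ β : Cochain P L m, ∀ p q (hpq : p + n = q), a - N < p →
      (δ m n β).v p q hpq = z.1.v p q hpq := by
    intro N
    induction N with
    | zero =>
      exact ⟨0, fun p q hpq hp => (P.isZero_of_isStrictlyLE a p (by lia)).eq_of_src _ _⟩
    | succ N ih =>
      obtain ⟨β, hβ⟩ := ih
      let p := a - N
      let g : P.X p ⟶ L.X (p + n) := z.1.v p (p + n) rfl - (δ m n β).v p (p + n) rfl
      have hg : g ≫ L.d (p + n) (p + n + 1) = 0 := by
        have h₁ := Cochain.congr_v (δ_δ m n (n + 1) β) p (p + n + 1) (by lia)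
        have h₂ := Cochain.congr_v (z.δ_eq_zero (n + 1)) p (p + n + 1) (by lia)
        rw [δ_v n (n + 1) rfl _ p _ _ (p + n) (p + 1) (by lia) (by lia)] at h₁ h₂
        rw [hβ (p + 1) (p + n + 1) (by lia) (by lia)] at h₁
        have h₃ := h₂.trans h₁.symm
        rw [add_left_inj] at h₃
        simpa only [g, Preadditive.sub_comp, sub_eq_zero] using h₃
      obtain ⟨s, hs⟩ := h p (p + m) (p + n) (p + n + 1) (by lia) rfl g hg
      refine ⟨β + Cochain.single s m, fun q q' hq hq' => ?_⟩
      rw [δ_add, Cochain.add_v,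
        δ_v m n hmn (Cochain.single s m) q q' hq (q + m) (q + 1) (by lia) rfl,
        Cochain.single_v_eq_zero _ _ (q + 1) _ _ (by lia), comp_zero, smul_zero, add_zero]
      by_cases hqp : q = p
      · subst hqp
        obtain rfl : q' = p + n := by lia
        rw [Cochain.single_v, hs]
        exact add_sub_cancel _ _
      · rw [Cochain.single_v_eq_zero _ _ q _ _ hqp, zero_comp, add_zero, hβ _ _ _ (by lia)]
  obtain ⟨β, hβ⟩ := key (a - b + n + 1).toNat
  refine ⟨β, Cochain.ext _ _ fun p q hpq => ?_⟩
  by_cases hq : q < b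
  · exact (L.isZero_of_isStrictlyGE b q hq).eq_of_tgt _ _
  · exact hβ p q hpq (by lia)

/-- `Ext` is the cohomology of the complex of morphisms between a left and a right resolution,
if this complex is invariant under replacing the right resolution with an injective one.
Here `π : P ⟶ X` and `ι : Y ⟶ Q` are the two resolutions. -/
lemma nonempty_ext_linearEquiv_homology [HasExt.{w} C] [EnoughInjectives C]
    {P Q : CochainComplex C ℤ}
    (π : P ⟶ (singleFunctor C 0).obj X) [QuasiIso π] (ι : (singleFunctor C 0).obj Y ⟶ Q)
    [QuasiIso ι]
    (h : ∀ (I : CochainComplex C ℤ) (φ : Q ⟶ I), I.IsStrictlyGE 0 →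
      (∀ i, Injective (I.X i)) → QuasiIso φ → HomAcyclic P (mappingCone φ)) :
    Nonempty (Abelian.Ext X Y n ≃ₗ[k] (linearHomComplex k P Q).homology n) := by
  let R : InjectiveResolution Y := InjectiveResolution.of Y
  have hcone {K L : CochainComplex C ℤ} (f : K ⟶ L) [QuasiIso f] :
      HomAcyclic (mappingCone f) R.cochainComplex := fun m n hmn z =>
    IsKInjective.eq_δ_of_cocycle z (acyclic_mappingCone f) m hmn
  obtain ⟨φ, hφ⟩ : ∃ φ : Q ⟶ R.cochainComplex, QuasiIso φ := by
    -- The augmentation of `R` extends along `ι`, up to homotopy.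
    obtain ⟨c, hc⟩ := (precompEquiv k ι R.cochainComplex 0 (hcone ι)).surjective
      (Submodule.Quotient.mk (Cocycle.ofHom R.ι'))
    obtain ⟨z, rfl⟩ := Submodule.Quotient.mk_surjective _ c
    obtain ⟨β, hβ⟩ := (mem_linearCoboundaries_iff (-1) (by simp)).1
      ((Submodule.Quotient.eq _).1 hc)
    have ho : Homotopy (ι ≫ z.homOf) R.ι' := (Cochain.equivHomotopy _ _).symm
      ⟨β, by
        rw [hβ, Cochain.ofHom_comp, Cocycle.cochain_ofHom_homOf_eq_coe]
        exact (sub_add_cancel _ _).symm⟩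
    have : QuasiIso (ι ≫ z.homOf) := by
      rw [quasiIso_iff]
      intro i
      rw [quasiIsoAt_iff_isIso_homologyMap, ho.homologyMap_eq]
      infer_instance
    exact ⟨z.homOf, quasiIso_of_comp_left ι z.homOf⟩
  exact ⟨(extLinearEquivOfInjectiveResolution k R n).symm ≪≫ₗ
    precompEquiv k π R.cochainComplex n (hcone π) ≪≫ₗ
    (postcompEquiv k φ P n (h _ φ inferInstance inferInstance hφ)).symm ≪≫ₗ
    (linearHomComplexHomologyEquiv k P Q n).symm⟩

end Ext

end

/-! ### Relatively injective and relatively projective tetramodules -/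

noncomputable section

namespace TetraStr

open TensorProduct

variable {k : Type v} {A : Type u} [Field k] [Ring A] [Bialgebra k A]
variable {M N P : Type u} [AddCommGroup M] [Module k M] [AddCommGroup N] [Module k N]
  [AddCommGroup P] [Module k P]

/-- The underlying bicomodule of a tetramodule: both actions are replaced with zero. -/
def toBicomodule (S : TetraStr k A M) : TetraStr k A M := ⟨0, 0, S.lcoact, S.rcoact⟩

/-- The underlying bimodule of a tetramodule: both coactions are replaced with zero. -/
def toBimodule (S : TetraStr k A M) : TetraStr k A M := ⟨S.lact, S.ract, 0, 0⟩

/-- The underlying right comodule of a tetramodule: the other structure maps are replaced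
with zero. -/
def toRightComodule (S : TetraStr k A M) : TetraStr k A M := ⟨0, 0, 0, S.rcoact⟩

/-- The structure of a tetramodule without the left action, which is replaced with zero. -/
def forgetLeft (S : TetraStr k A M) : TetraStr k A M := ⟨0, S.ract, S.lcoact, S.rcoact⟩

section Forget

variable {S : TetraStr k A M} {T : TetraStr k A N} {f : M →ₗ[k] N}

lemma mem_toBicomodule (hf : f ∈ homs S T) : f ∈ homs S.toBicomodule T.toBicomodule :=
  ⟨fun _ _ => map_zero f, fun _ _ => map_zero f, hf.2.2.1, hf.2.2.2⟩

lemma mem_toBimodule (hf : f ∈ homs S T) : f ∈ homs S.toBimodule T.toBimodule :=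
  ⟨hf.1, hf.2.1, fun _ => (map_zero (f.lTensor A)).symm, fun _ => (map_zero (f.rTensor A)).symm⟩

lemma mem_toRightComodule (hf : f ∈ homs S T) : f ∈ homs S.toRightComodule T.toRightComodule :=
  ⟨fun _ _ => map_zero f, fun _ _ => map_zero f, fun _ => (map_zero (f.lTensor A)).symm, hf.2.2.2⟩

lemma mem_forgetLeft (hf : f ∈ homs S T) : f ∈ homs S.forgetLeft T.forgetLeft :=
  ⟨fun _ _ => map_zero f, hf.2⟩

end Forget

section Box

variable {S : TetraStr k A M} {T : TetraStr k A N} {U : TetraStr k A P}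

lemma boxOne_rTensor_mem {f : M →ₗ[k] P} (hf : f ∈ homs S U) (T : TetraStr k A N) :
    f.rTensor N ∈ homs (S.boxOne T) (U.boxOne T) := by
  refine ⟨fun a z => ?_, fun a z => ?_, fun z => ?_, fun z => ?_⟩ <;> induction z with
    | zero => simp
    | add x y hx hy => simp only [map_add, hx, hy]
    | tmul m n => ?_
  · simp [hf.1]
  · simp
  · have := map_map₂_tetra (k := k) (p := LinearMap.mul k A) (q := TensorProduct.mk k M N)
      (p' := LinearMap.mul k A) (q' := TensorProduct.mk k P N) (f := LinearMap.id)
      (g := f.rTensor N) (f₁ := LinearMap.id) (f₂ := LinearMap.id) (g₁ := f) (g₂ := LinearMap.id)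
      (by simp) (by simp) (S.lcoact m) (T.lcoact n)
    simp only [TensorProduct.map_id, LinearMap.id_apply] at this
    simp only [boxOne_lcoact, LinearMap.rTensor_tmul, TensorProduct.lift.tmul,
      LinearMap.compl₁₂_apply, hf.2.2.1]
    exact this.symm
  · have := map_map₂_tetra (k := k) (q := LinearMap.mul k A) (p := TensorProduct.mk k M N)
      (q' := LinearMap.mul k A) (p' := TensorProduct.mk k P N) (g := LinearMap.id)
      (f := f.rTensor N) (f₁ := f) (g₁ := LinearMap.id) (g₂ := LinearMap.id) (f₂ := LinearMap.id)
      (by simp) (by simp) (S.rcoact m) (T.rcoact n)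
    simp only [TensorProduct.map_id, LinearMap.id_apply] at this
    simp only [boxOne_rcoact, LinearMap.rTensor_tmul, TensorProduct.lift.tmul,
      LinearMap.compl₁₂_apply, hf.2.2.2]
    exact this.symm

lemma boxTwo_rTensor_mem {f : M →ₗ[k] P} (hf : f ∈ homs S U) (T : TetraStr k A N) :
    f.rTensor N ∈ homs (S.boxTwo T) (U.boxTwo T) := by
  refine ⟨fun a z => ?_, fun a z => ?_, fun z => ?_, fun z => ?_⟩
  · have := map_map₂_tetra (k := k) (p := S.lact) (q := T.lact)
      (p' := U.lact) (q' := T.lact) (f := f)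
      (g := LinearMap.id) (f₁ := LinearMap.id) (f₂ := f) (g₁ := LinearMap.id) (g₂ := LinearMap.id)
      hf.1 (by simp) (Coalgebra.comul (R := k) a) z
    simp only [TensorProduct.map_id, LinearMap.id_apply] at this
    exact this
  · have := map_map₂_tetra (k := k) (p := S.ract) (q := T.ract)
      (p' := U.ract) (q' := T.ract) (f := f)
      (g := LinearMap.id) (f₁ := LinearMap.id) (f₂ := f) (g₁ := LinearMap.id) (g₂ := LinearMap.id)
      hf.2.1 (by simp) (Coalgebra.comul (R := k) a) z
    simp only [TensorProduct.map_id, LinearMap.id_apply] at this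
    exact this
  · induction z with
    | zero => simp
    | add x y hx hy => simp only [map_add, hx, hy]
    | tmul m n =>
      simp only [boxTwo_lcoact, LinearMap.rTensor_tmul, LinearMap.comp_apply,
        LinearEquiv.coe_coe, hf.2.2.1]
      generalize S.lcoact m = z
      induction z with
      | zero => simp
      | add x y hx hy => simp only [map_add, add_tmul, hx, hy]
      | tmul a b => simp
  · induction z with
    | zero => simp
    | add x y hx hy => simp only [map_add, hx, hy]
    | tmul m n =>
      simp only [boxTwo_rcoact, LinearMap.lTensor_tmul, LinearMap.comp_apply,
        LinearMap.rTensor_tmul, LinearEquiv.coe_coe]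
      generalize T.rcoact n = z
      induction z with
      | zero => simp
      | add x y hx hy => simp only [map_add, tmul_add, hx, hy]
      | tmul a b => simp

/-- The right action is a morphism of tetramodules `M ⊠₁ A ⟶ M`. -/
lemma lift_ract_mem (hS : ∀ m, S.LawfulAt m) :
    TensorProduct.lift S.ract.flip ∈ homs (S.boxOne (self k A)) S := by
  refine ⟨fun a z => ?_, fun a z => ?_, fun z => ?_, fun z => ?_⟩ <;> induction z with
    | zero => simp
    | add x y hx hy => simp only [map_add, hx, hy]
    | tmul m b => ?_
  · simp [(hS m).lact_ract]
  · simp [(hS m).mul_ract]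
  · have e (x : A ⊗[k] A) (y : A ⊗[k] M) :
        (TensorProduct.lift S.ract.flip).lTensor A
          (map₂ (LinearMap.mul k A) (TensorProduct.mk k M A) y x) =
        map₂ (LinearMap.mul k A).flip S.ract x y := by
      induction x with
      | zero => simp
      | add x x' hx hx' => simp only [map_add, LinearMap.add_apply, hx, hx']
      | tmul a b =>
        induction y with
        | zero => simp
        | add y y' hy hy' => simp only [map_add, LinearMap.add_apply, hy, hy']
        | tmul c d => simp
    simp [(hS m).lcoact_ract, e]
  · have e (x : A ⊗[k] A) (y : M ⊗[k] A) :
        (TensorProduct.lift S.ract.flip).rTensor A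
          (map₂ (TensorProduct.mk k M A) (LinearMap.mul k A) y x) =
        map₂ S.ract (LinearMap.mul k A).flip x y := by
      induction x with
      | zero => simp
      | add x x' hx hx' => simp only [map_add, LinearMap.add_apply, hx, hx']
      | tmul a b =>
        induction y with
        | zero => simp
        | add y y' hy hy' => simp only [map_add, LinearMap.add_apply, hy, hy']
        | tmul c d => simp
    simp [(hS m).rcoact_ract, e]

/-- The right coaction is a morphism of tetramodules `M ⟶ M ⊠₂ A`. -/
lemma rcoact_mem (hS : ∀ m, S.LawfulAt m) : S.rcoact ∈ homs S (S.boxTwo (self k A)) := by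
  refine ⟨fun a m => ?_, fun a m => ?_, fun m => ?_, fun m => ?_⟩
  · simp [(hS m).rcoact_lact]
  · simp [(hS m).rcoact_ract]
  · simp [(hS m).lcoact_rcoact]
  · simp [← (hS m).rcoact_coassoc]

end Box

section Sandwich

/-- The tetramodule `A ⊠₂ (M ⊠₂ A)`. Its coactions do not depend on the structure of `M`, and
its actions only on those of `M`: it is the cofree tetramodule on the bimodule `M`. -/
def cofree (S : TetraStr k A M) : TetraStr k A (A ⊗[k] (M ⊗[k] A)) :=
  (self k A).boxTwo (S.boxTwo (self k A))

/-- The tetramodule `A ⊠₁ (M ⊠₁ A)`. Its actions do not depend on the structure of `M`, and its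
coactions only on those of `M`: it is the free tetramodule on the bicomodule `M`. -/
def free (S : TetraStr k A M) : TetraStr k A (A ⊗[k] (M ⊗[k] A)) :=
  (self k A).boxOne (S.boxOne (self k A))

variable (A) in
/-- The map `id ⊗ f ⊗ id : A ⊗ M ⊗ A → A ⊗ N ⊗ A`. -/
def sandwich (f : M →ₗ[k] N) : A ⊗[k] (M ⊗[k] A) →ₗ[k] A ⊗[k] (N ⊗[k] A) :=
  (f.rTensor A).lTensor A

lemma sandwich_comp (g : N →ₗ[k] P) (f : M →ₗ[k] N) :
    sandwich A (g ∘ₗ f) = sandwich A g ∘ₗ sandwich A f := by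
  simp [sandwich, LinearMap.rTensor_comp, LinearMap.lTensor_comp]

/-- The two-sided coaction `M → A ⊗ M ⊗ A`. -/
def bicoact (S : TetraStr k A M) : M →ₗ[k] A ⊗[k] (M ⊗[k] A) :=
  S.rcoact.lTensor A ∘ₗ S.lcoact

/-- The two-sided action `A ⊗ M ⊗ A → M`. -/
def biact (S : TetraStr k A M) : A ⊗[k] (M ⊗[k] A) →ₗ[k] M :=
  TensorProduct.lift S.lact ∘ₗ (TensorProduct.lift S.ract.flip).lTensor A

variable {S : TetraStr k A M} {T : TetraStr k A N} {f : M →ₗ[k] N}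

/-- The bicomodule underlying a cofree tetramodule depends only on the vector space. -/
lemma cofree_toBicomodule_eq (S T : TetraStr k A M) :
    S.cofree.toBicomodule = T.cofree.toBicomodule := by
  simp only [toBicomodule, cofree, boxTwo]

/-- Cofree bicomodules are functorial with respect to all linear maps. -/
lemma sandwich_mem_cofree_toBicomodule (f : M →ₗ[k] N) :
    sandwich A f ∈ homs S.cofree.toBicomodule T.cofree.toBicomodule := by
  have h : f ∈ homs (k := k) (A := A) ⟨0, 0, 0, 0⟩ ⟨0, 0, 0, 0⟩ :=
    ⟨by simp, by simp, by simp, by simp⟩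
  rw [cofree_toBicomodule_eq S ⟨0, 0, 0, 0⟩, cofree_toBicomodule_eq T ⟨0, 0, 0, 0⟩]
  exact mem_toBicomodule (boxTwo_lTensor_mem (self k A) (boxTwo_rTensor_mem h (self k A)))

lemma bicoact_mem (hS : ∀ m, S.LawfulAt m) : S.bicoact ∈ homs S S.cofree :=
  comp_mem (lcoact_mem hS) (boxTwo_lTensor_mem (self k A) (rcoact_mem hS))

lemma biact_mem (hS : ∀ m, S.LawfulAt m) : S.biact ∈ homs S.free S :=
  comp_mem (boxOne_lTensor_mem (self k A) (lift_ract_mem hS)) (lift_lact_mem hS)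

lemma bicoact_comp (hf : f ∈ homs S.toBicomodule T.toBicomodule) :
    T.bicoact ∘ₗ f = sandwich A f ∘ₗ S.bicoact := by
  have hl : T.lcoact ∘ₗ f = f.lTensor A ∘ₗ S.lcoact := LinearMap.ext hf.2.2.1
  have hr : T.rcoact ∘ₗ f = f.rTensor A ∘ₗ S.rcoact := LinearMap.ext hf.2.2.2
  rw [bicoact, bicoact, sandwich, LinearMap.comp_assoc, hl, ← LinearMap.comp_assoc,
    ← LinearMap.lTensor_comp, hr, LinearMap.lTensor_comp, LinearMap.comp_assoc]

lemma comp_biact (hf : f ∈ homs S.toBimodule T.toBimodule) :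
    f ∘ₗ S.biact = T.biact ∘ₗ sandwich A f := by
  refine TensorProduct.ext' fun a z => ?_
  induction z with
  | zero => simp
  | add x y hx hy => simp only [tmul_add, map_add, hx, hy]
  | tmul m b =>
    have h₁ : ∀ a m, f (S.lact a m) = T.lact a (f m) := hf.1
    have h₂ : ∀ a m, f (S.ract a m) = T.ract a (f m) := hf.2.1
    simp [biact, sandwich, h₁, h₂]

/-- The cofree tetramodule is functorial in the underlying bimodule. -/
lemma sandwich_mem_cofree (hf : f ∈ homs S.toBimodule T.toBimodule) :
    sandwich A f ∈ homs S.cofree T.cofree := by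
  have h := mem_toBimodule (boxTwo_rTensor_mem hf (self k A))
  have h' := sandwich_mem_cofree_toBicomodule (S := S) (T := T) f
  have h := boxTwo_lTensor_mem (self k A) h
  exact ⟨h.1, h.2.1, h'.2.2.1, h'.2.2.2⟩

/-- The free tetramodule is functorial in the underlying bicomodule. -/
lemma sandwich_mem_free (hf : f ∈ homs S.toBicomodule T.toBicomodule) :
    sandwich A f ∈ homs S.free T.free := by
  have h := boxOne_lTensor_mem (self k A) (mem_forgetLeft (boxOne_rTensor_mem hf (self k A)))
  exact h

end Sandwich

section Relative

/-- A tetramodule is relatively injective if it is a direct summand, as a bicomodule, of its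
cofree tetramodule. Over a field, this says that its underlying bicomodule is injective. -/
def RelInjective (S : TetraStr k A M) : Prop :=
  ∃ r ∈ homs S.cofree.toBicomodule S.toBicomodule, r ∘ₗ S.bicoact = LinearMap.id

/-- A tetramodule is relatively projective if it is a direct summand of its free tetramodule. -/
def RelProjective (S : TetraStr k A M) : Prop :=
  ∃ s ∈ homs S S.free, S.biact ∘ₗ s = LinearMap.id

lemma _root_.LinearMap.exists_comp_eq_of_ker_le {V V' V'' : Type*} [AddCommGroup V]
    [Module k V] [AddCommGroup V'] [Module k V'] [AddCommGroup V''] [Module k V'']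
    (d : V →ₗ[k] V') (e : V →ₗ[k] V'') (h : LinearMap.ker d ≤ LinearMap.ker e) :
    ∃ g : V' →ₗ[k] V'', g ∘ₗ d = e := by
  obtain ⟨g, hg⟩ := LinearMap.exists_extend
    ((LinearMap.ker d).liftQ e h ∘ₗ d.quotKerEquivRange.symm.toLinearMap)
  refine ⟨g, LinearMap.ext fun x => ?_⟩
  have := LinearMap.congr_fun hg (d.rangeRestrict x)
  have e' : d.quotKerEquivRange.symm (d.rangeRestrict x) = Submodule.Quotient.mk x := by
    rw [LinearEquiv.symm_apply_eq]; rfl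
  simpa [e'] using this

variable {S : TetraStr k A M} {T : TetraStr k A N} {U : TetraStr k A P} {f : M →ₗ[k] N}
  {g : N →ₗ[k] P}

/-- Bicomodule splittings propagate along exact sequences of relatively injective tetramodules. -/
lemma RelInjective.exists_split (hT : T.RelInjective)
    (hf : f ∈ homs S T) (hg : g ∈ homs T U) (hfg : LinearMap.ker g ≤ LinearMap.range f)
    (w : g ∘ₗ f = 0)
    {s : N →ₗ[k] M} (hs : s ∈ homs T.toBicomodule S.toBicomodule) (h : f ∘ₗ s ∘ₗ f = f)
    (hU : ∀ m, U.LawfulAt m) :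
    ∃ t ∈ homs U.toBicomodule T.toBicomodule, g ∘ₗ t ∘ₗ g = g := by
  obtain ⟨r, hr, hr'⟩ := hT
  have he := (homs T.toBicomodule T.toBicomodule).sub_mem id_mem
    (comp_mem hs (mem_toBicomodule hf))
  -- `e = 1 - f s` is an idempotent endomorphism of the bicomodule `N` with kernel `ker g`, so
  -- it factors through `g` linearly; averaging with `r` makes the factor bicolinear.
  obtain ⟨t₀, ht₀⟩ := LinearMap.exists_comp_eq_of_ker_le g (LinearMap.id - f ∘ₗ s) (by
    intro x hx
    obtain ⟨y, rfl⟩ := hfg hx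
    simpa [sub_eq_zero] using (LinearMap.congr_fun h y).symm)
  refine ⟨r ∘ₗ sandwich A t₀ ∘ₗ U.bicoact, comp_mem (comp_mem
    (mem_toBicomodule (bicoact_mem hU)) (sandwich_mem_cofree_toBicomodule t₀)) hr, ?_⟩
  have : (r ∘ₗ sandwich A t₀ ∘ₗ U.bicoact) ∘ₗ g = LinearMap.id - f ∘ₗ s := by
    rw [LinearMap.comp_assoc, LinearMap.comp_assoc, bicoact_comp (mem_toBicomodule hg),
      ← LinearMap.comp_assoc _ _ (sandwich A t₀), ← sandwich_comp, ht₀, ← bicoact_comp he,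
      ← LinearMap.comp_assoc, hr', LinearMap.id_comp]
  rw [this, LinearMap.comp_sub, LinearMap.comp_id, ← LinearMap.comp_assoc, w,
    LinearMap.zero_comp, sub_zero]

/-- Morphisms from a relatively projective tetramodule lift along surjections which split
over bicomodules. -/
lemma RelProjective.exists_lift (hU : U.RelProjective) (hf : f ∈ homs S T)
    {s : N →ₗ[k] M} (hs : s ∈ homs T.toBicomodule S.toBicomodule) (h : f ∘ₗ s ∘ₗ f = f)
    {g : P →ₗ[k] N} (hg : g ∈ homs U T) (hfg : LinearMap.range g ≤ LinearMap.range f)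
    (hS : ∀ m, S.LawfulAt m) :
    ∃ l ∈ homs U S, f ∘ₗ l = g := by
  obtain ⟨σ, hσ, hσ'⟩ := hU
  have hsg : f ∘ₗ (s ∘ₗ g) = g := LinearMap.ext fun x => by
    obtain ⟨y, hy⟩ := hfg ⟨x, rfl⟩
    have := LinearMap.congr_fun h y
    simpa [hy] using this
  refine ⟨S.biact ∘ₗ sandwich A (s ∘ₗ g) ∘ₗ σ, comp_mem (comp_mem hσ (sandwich_mem_free
    (comp_mem (mem_toBicomodule hg) hs))) (biact_mem hS), ?_⟩
  rw [← LinearMap.comp_assoc, comp_biact (mem_toBimodule hf), LinearMap.comp_assoc,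
    ← LinearMap.comp_assoc _ _ (sandwich A f), ← sandwich_comp, hsg, ← LinearMap.comp_assoc,
    ← comp_biact (mem_toBimodule hg), LinearMap.comp_assoc, hσ', LinearMap.comp_id]

end Relative

end TetraStr

end

/-! ### Relative injectivity and projectivity of external products -/

noncomputable section

namespace TetraStr

open TensorProduct

variable {k : Type v} {A : Type u} [Field k] [Ring A] [Bialgebra k A]
variable {M N P : Type u} [AddCommGroup M] [Module k M] [AddCommGroup N] [Module k N]
  [AddCommGroup P] [Module k P]

section Forget

variable (S : TetraStr k A M) (T : TetraStr k A N)

lemma boxTwo_toRightComodule_toBicomodule :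
    (S.boxTwo T.toRightComodule).toBicomodule = (S.boxTwo T).toBicomodule := by
  simp only [boxTwo, toBicomodule, toRightComodule]

lemma boxTwo_toRightComodule_toRightComodule :
    (S.boxTwo T.toRightComodule).toRightComodule = (S.boxTwo T).toRightComodule := by
  simp only [boxTwo, toRightComodule]

lemma boxOne_forgetLeft : S.boxOne T.forgetLeft = S.boxOne T := by
  simp only [boxOne, forgetLeft]

lemma forgetLeft_boxOne_forgetLeft :
    (S.forgetLeft.boxOne T).forgetLeft = (S.boxOne T).forgetLeft := by
  simp only [boxOne, forgetLeft]

end Forget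

section BoxTwo

variable (k A) in
/-- The map `ε ⊗ id : A ⊗ N → N`. -/
def counitLeft (N : Type u) [AddCommGroup N] [Module k N] : A ⊗[k] N →ₗ[k] N :=
  TensorProduct.lid k N ∘ₗ (Coalgebra.counit (R := k) (A := A)).rTensor N

lemma counitLeft_tmul (a : A) (n : N) :
    counitLeft k A N (a ⊗ₜ n) = Coalgebra.counit (R := k) a • n := by
  simp [counitLeft]

variable (T : TetraStr k A N)

/-- The right coaction of `A ⊠₂ T` is that of `T`, so `ε ⊗ id` commutes with it; it need not commute
with the left coaction. -/
lemma counitLeft_mem : counitLeft k A N ∈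
    homs ((self k A).boxTwo T).toRightComodule T.toRightComodule := by
  refine ⟨fun _ _ => map_zero _, fun _ _ => map_zero _,
    fun _ => (map_zero ((counitLeft k A N).lTensor A)).symm, fun z => ?_⟩
  change T.rcoact _ = _
  induction z with
  | zero => simp
  | add x y hx hy => simp only [map_add, hx, hy]
  | tmul a n =>
    simp only [counitLeft_tmul, map_smul, toRightComodule, boxTwo_rcoact, LinearMap.comp_apply,
      LinearMap.lTensor_tmul, LinearEquiv.coe_coe]
    generalize T.rcoact n = z
    induction z with
    | zero => simp
    | add x y hx hy => simp only [map_add, smul_add, tmul_add, hx, hy]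
    | tmul m b => simp [counitLeft_tmul, smul_tmul']

lemma counitLeft_lTensor_lcoact :
    (counitLeft k A N).lTensor A ∘ₗ ((self k A).boxTwo T).lcoact = LinearMap.id := by
  refine TensorProduct.ext' fun a n => ?_
  have e (z : A ⊗[k] A) : (counitLeft k A N).lTensor A (TensorProduct.assoc k A A N (z ⊗ₜ n)) =
      TensorProduct.rid k A ((Coalgebra.counit (R := k) (A := A)).lTensor A z) ⊗ₜ n := by
    induction z with
    | zero => simp
    | add x y hx hy => simp only [map_add, add_tmul, hx, hy]
    | tmul b c => simp [counitLeft_tmul, smul_tmul']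
  simp [e]

/-- A right comodule is relatively injective if its coaction is a split monomorphism of right
comodules. -/
def RightRelInjective (S : TetraStr k A M) : Prop :=
  ∃ r ∈ homs (S.boxTwo (self k A)).toRightComodule S.toRightComodule,
    r ∘ₗ S.rcoact = LinearMap.id

variable (k A) in
lemma rightRelInjective_self : (self k A).RightRelInjective := by
  refine ⟨_, counitLeft_mem _, LinearMap.ext fun a => ?_⟩
  simp [counitLeft]

variable {T}

lemma RightRelInjective.boxTwo (hT : T.RightRelInjective) (S : TetraStr k A M) :
    (S.boxTwo T).RightRelInjective := by
  obtain ⟨r, hr, hr'⟩ := hT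
  have ha : (TensorProduct.assoc k M N A).toLinearMap ∈
      homs ((S.boxTwo T).boxTwo (self k A)).toRightComodule
        (S.boxTwo (T.boxTwo (self k A))).toRightComodule := by
    refine ⟨fun _ _ => map_zero _, fun _ _ => map_zero _,
      fun _ => (map_zero (((TensorProduct.assoc k M N A).toLinearMap).lTensor A)).symm,
      LinearMap.congr_fun (f := (S.boxTwo (T.boxTwo (self k A))).rcoact ∘ₗ
        (TensorProduct.assoc k M N A).toLinearMap)
        (g := (TensorProduct.assoc k M N A).toLinearMap.rTensor A ∘ₗ
          ((S.boxTwo T).boxTwo (self k A)).rcoact) (TensorProduct.ext_threefold fun m n a => ?_)⟩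
    simp only [boxTwo_rcoact, LinearMap.comp_apply, self_rcoact,
      LinearMap.lTensor_tmul, LinearEquiv.coe_coe, TensorProduct.assoc_tmul]
    generalize Coalgebra.comul (R := k) a = z
    induction z with
    | zero => simp
    | add x y hx hy => simp only [map_add, tmul_add, hx, hy]
    | tmul b c => simp
  have h := mem_toRightComodule (boxTwo_lTensor_mem S hr)
  rw [boxTwo_toRightComodule_toRightComodule, boxTwo_toRightComodule_toRightComodule] at h
  refine ⟨r.lTensor M ∘ₗ (TensorProduct.assoc k M N A).toLinearMap, comp_mem ha h, ?_⟩
  have : (TensorProduct.assoc k M N A).toLinearMap ∘ₗ (S.boxTwo T).rcoact =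
      T.rcoact.lTensor M := by
    ext; simp
  rw [LinearMap.comp_assoc, this, ← LinearMap.lTensor_comp, hr', LinearMap.lTensor_id]

/-- If `r` is a retraction of the right coaction of `T`, then `(id ⊗ r) ∘ (id ⊗ ε ⊗ id ⊗ id)` is
a bicolinear retraction of the two-sided coaction of `A ⊠₂ T`. -/
lemma RightRelInjective.relInjective (hT : T.RightRelInjective) :
    ((self k A).boxTwo T).RelInjective := by
  obtain ⟨r, hr, hr'⟩ := hT
  have h := mem_toBicomodule (boxTwo_lTensor_mem (self k A) hr)
  rw [boxTwo_toRightComodule_toBicomodule, boxTwo_toRightComodule_toBicomodule] at h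
  refine ⟨r.lTensor A ∘ₗ sandwich A (counitLeft k A N),
    comp_mem (sandwich_mem_cofree_toBicomodule (T := T) _) h, ?_⟩
  have hu : (counitLeft k A N).rTensor A ∘ₗ ((self k A).boxTwo T).rcoact =
      T.rcoact ∘ₗ counitLeft k A N := (rcoact_comp_of_mem (counitLeft_mem T)).symm
  have hu' : ∀ z, sandwich A (counitLeft k A N) (((self k A).boxTwo T).rcoact.lTensor A z) =
      T.rcoact.lTensor A ((counitLeft k A N).lTensor A z) := fun z => by
    rw [sandwich, ← LinearMap.lTensor_comp_apply, hu, LinearMap.lTensor_comp_apply]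
  refine LinearMap.ext fun x => ?_
  have hx := LinearMap.congr_fun (counitLeft_lTensor_lcoact T) x
  rw [LinearMap.comp_apply] at hx
  simp only [bicoact, LinearMap.comp_apply]
  rw [hu', hx, ← LinearMap.lTensor_comp_apply, hr', LinearMap.lTensor_id]
  rfl

end BoxTwo

section BoxOne

/-- A tetramodule is relatively projective on the right if its right action has a section
which is a morphism of right modules and of bicomodules. -/
def RightRelProjective (S : TetraStr k A M) : Prop :=
  ∃ s ∈ homs S.forgetLeft (S.boxOne (self k A)).forgetLeft,
    TensorProduct.lift S.ract.flip ∘ₗ s = LinearMap.id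

variable (T : TetraStr k A N)

/-- The insertion of a unit on the left is compatible with the right action and with both
coactions. -/
lemma mk_one_mem : TensorProduct.mk k A N 1 ∈
    homs T.forgetLeft ((self k A).boxOne T).forgetLeft := by
  refine ⟨fun _ _ => map_zero _, fun a n => ?_, fun n => ?_, fun n => ?_⟩
  · simp [forgetLeft]
  · simp only [forgetLeft, boxOne_lcoact, TensorProduct.mk_apply, TensorProduct.lift.tmul,
      LinearMap.compl₁₂_apply, self_lcoact, Bialgebra.comul_one, Algebra.TensorProduct.one_def]
    generalize T.lcoact n = z
    induction z with
    | zero => simp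
    | add x y hx hy => simp only [map_add, hx, hy]
    | tmul b c => simp
  · simp only [forgetLeft, boxOne_rcoact, TensorProduct.mk_apply, TensorProduct.lift.tmul,
      LinearMap.compl₁₂_apply, self_rcoact, Bialgebra.comul_one, Algebra.TensorProduct.one_def]
    generalize T.rcoact n = z
    induction z with
    | zero => simp
    | add x y hx hy => simp only [map_add, hx, hy]
    | tmul b c => simp

variable (k A) in
lemma rightRelProjective_self : (self k A).RightRelProjective := by
  refine ⟨_, mk_one_mem _, LinearMap.ext fun a => ?_⟩
  simp

variable {T}

lemma RightRelProjective.boxOne (hT : T.RightRelProjective) (S : TetraStr k A M) :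
    (S.boxOne T).RightRelProjective := by
  obtain ⟨s, hs, hs'⟩ := hT
  have ha : (TensorProduct.assoc k M N A).symm.toLinearMap ∈
      homs (S.boxOne (T.boxOne (self k A))) ((S.boxOne T).boxOne (self k A)) := by
    refine ⟨fun a => LinearMap.congr_fun (f := (TensorProduct.assoc k M N A).symm.toLinearMap ∘ₗ
        (S.boxOne (T.boxOne (self k A))).lact a) (g := ((S.boxOne T).boxOne (self k A)).lact a ∘ₗ
        (TensorProduct.assoc k M N A).symm.toLinearMap) ?_,
      fun a => LinearMap.congr_fun (f := (TensorProduct.assoc k M N A).symm.toLinearMap ∘ₗ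
        (S.boxOne (T.boxOne (self k A))).ract a) (g := ((S.boxOne T).boxOne (self k A)).ract a ∘ₗ
        (TensorProduct.assoc k M N A).symm.toLinearMap) ?_,
      LinearMap.congr_fun (f := ((S.boxOne T).boxOne (self k A)).lcoact ∘ₗ
        (TensorProduct.assoc k M N A).symm.toLinearMap)
        (g := (TensorProduct.assoc k M N A).symm.toLinearMap.lTensor A ∘ₗ
          (S.boxOne (T.boxOne (self k A))).lcoact) ?_,
      LinearMap.congr_fun (f := ((S.boxOne T).boxOne (self k A)).rcoact ∘ₗ
        (TensorProduct.assoc k M N A).symm.toLinearMap)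
        (g := (TensorProduct.assoc k M N A).symm.toLinearMap.rTensor A ∘ₗ
          (S.boxOne (T.boxOne (self k A))).rcoact) ?_⟩ <;>
      refine TensorProduct.ext_threefold' fun m n b => ?_
    · simp
    · simp
    · simp only [LinearMap.comp_apply, LinearEquiv.coe_coe, TensorProduct.assoc_symm_tmul,
        boxOne_lcoact, TensorProduct.lift.tmul, LinearMap.compl₁₂_apply]
      generalize S.lcoact m = x
      generalize T.lcoact n = y
      generalize (self k A).lcoact b = z
      induction x with
      | zero => simp
      | add x x' hx hx' => simp only [map_add, LinearMap.add_apply, hx, hx']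
      | tmul a m =>
        induction y with
        | zero => simp
        | add y y' hy hy' => simp only [map_add, LinearMap.add_apply, hy, hy']
        | tmul b n =>
          induction z with
          | zero => simp
          | add y y' hy hy' => simp only [map_add, hy, hy']
          | tmul c d => simp [mul_assoc]
    · simp only [LinearMap.comp_apply, LinearEquiv.coe_coe, TensorProduct.assoc_symm_tmul,
        boxOne_rcoact, TensorProduct.lift.tmul, LinearMap.compl₁₂_apply]
      generalize S.rcoact m = x
      generalize T.rcoact n = y
      generalize (self k A).rcoact b = z
      induction x with
      | zero => simp
      | add x x' hx hx' => simp only [map_add, LinearMap.add_apply, hx, hx']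
      | tmul m a =>
        induction y with
        | zero => simp
        | add y y' hy hy' => simp only [map_add, LinearMap.add_apply, hy, hy']
        | tmul n b =>
          induction z with
          | zero => simp
          | add y y' hy hy' => simp only [map_add, hy, hy']
          | tmul d c => simp [mul_assoc]
  have h := mem_forgetLeft (boxOne_lTensor_mem S hs)
  rw [boxOne_forgetLeft, boxOne_forgetLeft] at h
  refine ⟨(TensorProduct.assoc k M N A).symm.toLinearMap ∘ₗ s.lTensor M,
    comp_mem h (mem_forgetLeft ha), ?_⟩
  have : TensorProduct.lift (S.boxOne T).ract.flip ∘ₗ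
      (TensorProduct.assoc k M N A).symm.toLinearMap =
      (TensorProduct.lift T.ract.flip).lTensor M := by
    refine TensorProduct.ext_threefold' fun m n a => ?_
    simp
  rw [← LinearMap.comp_assoc, this, ← LinearMap.lTensor_comp, hs', LinearMap.lTensor_id]

/-- If `s` is a section of the right action of `T`, then `id ⊗ (1 ⊗ s)` is a section of the
two-sided action on `A ⊠₁ T`. It commutes with the left coaction because `1` is grouplike. -/
lemma RightRelProjective.relProjective (hT : T.RightRelProjective) :
    ((self k A).boxOne T).RelProjective := by
  obtain ⟨s, hs, hs'⟩ := hT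
  have h := mem_forgetLeft (boxOne_rTensor_mem (mk_one_mem T) (self k A))
  rw [forgetLeft_boxOne_forgetLeft, forgetLeft_boxOne_forgetLeft] at h
  have h : (TensorProduct.mk k A N 1).rTensor A ∘ₗ s ∈
    homs T.forgetLeft (((self k A).boxOne T).boxOne (self k A)).forgetLeft := comp_mem hs h
  have hl := boxOne_lTensor_mem (self k A) h
  rw [boxOne_forgetLeft, boxOne_forgetLeft] at hl
  refine ⟨((TensorProduct.mk k A N 1).rTensor A ∘ₗ s).lTensor A, hl, ?_⟩
  have hu : TensorProduct.lift ((self k A).boxOne T).ract.flip ∘ₗ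
      (TensorProduct.mk k A N 1).rTensor A =
      TensorProduct.mk k A N 1 ∘ₗ TensorProduct.lift T.ract.flip := by
    ext; simp
  have hu' : TensorProduct.lift ((self k A).boxOne T).lact ∘ₗ
      (TensorProduct.mk k A N 1).lTensor A = LinearMap.id := by
    ext; simp
  rw [biact, LinearMap.comp_assoc, ← LinearMap.lTensor_comp, ← LinearMap.comp_assoc s, hu,
    LinearMap.comp_assoc, hs', LinearMap.comp_id, hu']

end BoxOne

end TetraStr

end

/-! ### Enough injective tetramodules -/

noncomputable section

namespace TetraStr

open TensorProduct

variable {k : Type v} {A : Type u} [Field k] [Ring A] [Bialgebra k A]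
variable {M N P : Type u} [AddCommGroup M] [Module k M] [AddCommGroup N] [Module k N]
  [AddCommGroup P] [Module k P]

section Counit

variable (k A) in
/-- The map `id ⊗ ε : N ⊗ A → N`. -/
def counitRight (N : Type u) [AddCommGroup N] [Module k N] : N ⊗[k] A →ₗ[k] N :=
  TensorProduct.rid k N ∘ₗ (Coalgebra.counit (R := k) (A := A)).lTensor N

lemma counitRight_tmul (a : A) (n : N) :
    counitRight k A N (n ⊗ₜ a) = Coalgebra.counit (R := k) a • n := by
  simp [counitRight]

variable (k A) in
/-- The map `ε ⊗ id ⊗ ε : A ⊗ N ⊗ A → N`. -/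
def bicounit (N : Type u) [AddCommGroup N] [Module k N] : A ⊗[k] (N ⊗[k] A) →ₗ[k] N :=
  counitLeft k A N ∘ₗ (counitRight k A N).lTensor A

lemma bicounit_tmul (a b : A) (n : N) : bicounit k A N (a ⊗ₜ (n ⊗ₜ b)) =
    Coalgebra.counit (R := k) a • Coalgebra.counit (R := k) b • n := by
  simp only [bicounit, LinearMap.comp_apply, LinearMap.lTensor_tmul, counitLeft_tmul,
    counitRight_tmul]

lemma comp_bicounit (f : M →ₗ[k] N) : f ∘ₗ bicounit k A M = bicounit k A N ∘ₗ sandwich A f := by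
  refine TensorProduct.ext_threefold' fun a n b => ?_
  simp [bicounit_tmul, sandwich]

variable (T : TetraStr k A N)

lemma counitLeft_mem_toBimodule :
    counitLeft k A N ∈ homs ((self k A).boxTwo T).toBimodule T.toBimodule := by
  have h₁ (x : A ⊗[k] A) (a : A) (n : N) :
      counitLeft k A N (map₂ (self k A).lact T.lact x (a ⊗ₜ n)) =
      T.lact (TensorProduct.lid k A ((Coalgebra.counit (R := k) (A := A)).rTensor A x))
        (counitLeft k A N (a ⊗ₜ n)) := by
    induction x with
    | zero => simp
    | add x y hx hy => simp only [map_add, LinearMap.add_apply, hx, hy]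
    | tmul b c =>
      simp only [map₂_apply_tmul, self_lact, LinearMap.mul_apply', counitLeft_tmul,
        Bialgebra.counit_mul, mul_smul, map_smul, LinearMap.rTensor_tmul, lid_tmul,
        LinearMap.smul_apply, TensorProduct.map_tmul]
      rw [smul_comm]
  have h₂ (x : A ⊗[k] A) (a : A) (n : N) :
      counitLeft k A N (map₂ (self k A).ract T.ract x (a ⊗ₜ n)) =
      T.ract (TensorProduct.lid k A ((Coalgebra.counit (R := k) (A := A)).rTensor A x))
        (counitLeft k A N (a ⊗ₜ n)) := by
    induction x with
    | zero => simp
    | add x y hx hy => simp only [map_add, LinearMap.add_apply, hx, hy]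
    | tmul b c => simp [counitLeft_tmul, mul_smul]
  refine ⟨fun c z => ?_, fun c z => ?_, fun _ => (map_zero ((counitLeft k A N).lTensor A)).symm,
    fun _ => (map_zero ((counitLeft k A N).rTensor A)).symm⟩ <;> induction z with
    | zero => simp
    | add x y hx hy => simp only [map_add, hx, hy]
    | tmul a n => ?_
  · refine (h₁ _ _ _).trans ?_
    simp [toBimodule]
  · refine (h₂ _ _ _).trans ?_
    simp [toBimodule]

lemma counitRight_mem_toBimodule :
    counitRight k A N ∈ homs (T.boxTwo (self k A)).toBimodule T.toBimodule := by
  have h₁ (x : A ⊗[k] A) (a : A) (n : N) :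
      counitRight k A N (map₂ T.lact (self k A).lact x (n ⊗ₜ a)) =
      T.lact (TensorProduct.rid k A ((Coalgebra.counit (R := k) (A := A)).lTensor A x))
        (counitRight k A N (n ⊗ₜ a)) := by
    induction x with
    | zero => simp
    | add x y hx hy => simp only [map_add, LinearMap.add_apply, hx, hy]
    | tmul b c =>
      simp only [map₂_apply_tmul, self_lact, LinearMap.mul_apply', counitRight_tmul,
        Bialgebra.counit_mul, mul_smul, map_smul, LinearMap.lTensor_tmul, rid_tmul,
        LinearMap.smul_apply, TensorProduct.map_tmul]
      rw [smul_comm]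
  have h₂ (x : A ⊗[k] A) (a : A) (n : N) :
      counitRight k A N (map₂ T.ract (self k A).ract x (n ⊗ₜ a)) =
      T.ract (TensorProduct.rid k A ((Coalgebra.counit (R := k) (A := A)).lTensor A x))
        (counitRight k A N (n ⊗ₜ a)) := by
    induction x with
    | zero => simp
    | add x y hx hy => simp only [map_add, LinearMap.add_apply, hx, hy]
    | tmul b c => simp [counitRight_tmul, mul_smul]
  refine ⟨fun c z => ?_, fun c z => ?_, fun _ => (map_zero ((counitRight k A N).lTensor A)).symm,
    fun _ => (map_zero ((counitRight k A N).rTensor A)).symm⟩ <;> induction z with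
    | zero => simp
    | add x y hx hy => simp only [map_add, hx, hy]
    | tmul n a => ?_
  · refine (h₁ _ _ _).trans ?_
    simp [toBimodule]
  · refine (h₂ _ _ _).trans ?_
    simp [toBimodule]

lemma boxTwo_toBimodule (S : TetraStr k A M) (T : TetraStr k A N) :
    (S.boxTwo T.toBimodule).toBimodule = (S.boxTwo T).toBimodule := by
  simp only [boxTwo, toBimodule]

/-- The counit of the adjunction between tetramodules and bimodules. -/
lemma bicounit_mem : bicounit k A N ∈ homs T.cofree.toBimodule T.toBimodule := by
  have h := mem_toBimodule (boxTwo_lTensor_mem (self k A) (counitRight_mem_toBimodule T))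
  rw [boxTwo_toBimodule, boxTwo_toBimodule] at h
  exact comp_mem h (counitLeft_mem_toBimodule T)

variable {T} in
lemma bicounit_bicoact (hT : ∀ n, T.LawfulAt n) : bicounit k A N ∘ₗ T.bicoact = LinearMap.id := by
  have hr : counitRight k A N ∘ₗ T.rcoact = LinearMap.id := LinearMap.ext fun n => by
    simp [counitRight, (hT n).rcoact_counit]
  refine LinearMap.ext fun n => ?_
  simp only [bicounit, bicoact, LinearMap.comp_apply]
  rw [← LinearMap.lTensor_comp_apply, hr, LinearMap.lTensor_id, LinearMap.id_apply, counitLeft,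
    LinearMap.comp_apply, (hT n).lcoact_counit]
  simp

/-- One of the triangle identities of the adjunction between tetramodules and bimodules. -/
lemma sandwich_bicounit_bicoact :
    sandwich A (bicounit k A N) ∘ₗ T.cofree.bicoact = LinearMap.id := by
  have e₁ (a : A) (n : N) (y : A ⊗[k] A) : (bicounit k A N).rTensor A
      ((TensorProduct.assoc k A (N ⊗[k] A) A).symm
        (a ⊗ₜ (TensorProduct.assoc k N A A).symm (n ⊗ₜ y))) =
      Coalgebra.counit (R := k) a •
        (n ⊗ₜ TensorProduct.lid k A ((Coalgebra.counit (R := k) (A := A)).rTensor A y)) := by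
    induction y with
    | zero => simp
    | add x y hx hy => simp only [map_add, tmul_add, smul_add, hx, hy]
    | tmul b c => simp [bicounit_tmul, smul_tmul']
  have e₂ (x : A ⊗[k] A) (n : N) (b : A) : sandwich A (bicounit k A N)
      (T.cofree.rcoact.lTensor A (TensorProduct.assoc k A A (N ⊗[k] A) (x ⊗ₜ (n ⊗ₜ b)))) =
      TensorProduct.rid k A ((Coalgebra.counit (R := k) (A := A)).lTensor A x) ⊗ₜ (n ⊗ₜ b) := by
    induction x with
    | zero => simp
    | add x y hx hy => simp only [map_add, add_tmul, hx, hy]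
    | tmul c d => simp [sandwich, cofree, e₁, smul_tmul]
  refine TensorProduct.ext_threefold' fun a n b => ?_
  refine (e₂ (Coalgebra.comul a) n b).trans ?_
  simp

variable {T} in
/-- A bicolinear map to a cofree tetramodule is recovered from its composition with the counit. -/
lemma sandwich_bicounit_comp {S : TetraStr k A M} {f : M →ₗ[k] A ⊗[k] (N ⊗[k] A)}
    (hf : f ∈ homs S.toBicomodule T.cofree.toBicomodule) :
    sandwich A (bicounit k A N ∘ₗ f) ∘ₗ S.bicoact = f := by
  rw [sandwich_comp, LinearMap.comp_assoc, ← bicoact_comp hf, ← LinearMap.comp_assoc,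
    sandwich_bicounit_bicoact, LinearMap.id_comp]

end Counit

section Lawful

variable (S : TetraStr k A M) (V : Type u) [AddCommGroup V] [Module k V]

/-- The tensor product of a tetramodule and a vector space, a direct sum of copies of the
tetramodule. -/
def tensorSpace : TetraStr k A (M ⊗[k] V) where
  lact := LinearMap.rTensorHom V ∘ₗ S.lact
  ract := LinearMap.rTensorHom V ∘ₗ S.ract
  lcoact := (TensorProduct.assoc k A M V).toLinearMap ∘ₗ S.lcoact.rTensor V
  rcoact := (TensorProduct.rightComm k M A V).toLinearMap ∘ₗ S.rcoact.rTensor V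

variable {S} in
lemma tensorSpace_lawful (hS : ∀ m, S.LawfulAt m) (z : M ⊗[k] V) :
    (S.tensorSpace V).LawfulAt z := by
  refine lawful_of_tmul _ (fun m x => ?_) z
  have h : (TensorProduct.mk k M V).flip x ∈ homs S (S.tensorSpace V) := by
    refine ⟨fun a m => by simp [tensorSpace], fun a m => by simp [tensorSpace], fun m => ?_,
      fun m => ?_⟩
    · simp only [tensorSpace, LinearMap.comp_apply, LinearMap.flip_apply, mk_apply,
        LinearMap.rTensor_tmul]
      generalize S.lcoact m = z
      induction z with
      | zero => simp
      | add x y hx hy => simp only [map_add, add_tmul, hx, hy]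
      | tmul a b => simp
    · simp only [tensorSpace, LinearMap.comp_apply, LinearMap.flip_apply, mk_apply,
        LinearMap.rTensor_tmul]
      generalize S.rcoact m = z
      induction z with
      | zero => simp
      | add x y hx hy => simp only [map_add, add_tmul, hx, hy]
      | tmul a b => simp
  exact (hS m).map h

variable {T : TetraStr k A N}

/-- The cofree tetramodule on a bimodule satisfies the axioms. It is a quotient of the
cofree tetramodule on the free bimodule `(A ⊗ A) ⊗ N`, which underlies a tetramodule. -/
lemma cofree_lawful (h₁ : ∀ n, T.lact 1 n = n)
    (h₂ : ∀ a b n, T.lact (a * b) n = T.lact a (T.lact b n))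
    (h₃ : ∀ n, T.ract 1 n = n) (h₄ : ∀ a b n, T.ract (a * b) n = T.ract b (T.ract a n))
    (h₅ : ∀ a b n, T.lact a (T.ract b n) = T.ract b (T.lact a n)) (z : A ⊗[k] (N ⊗[k] A)) :
    T.cofree.LawfulAt z := by
  let F := ((self k A).boxOne (self k A)).tensorSpace N
  let p : (A ⊗[k] A) ⊗[k] N →ₗ[k] N := TensorProduct.lift (TensorProduct.lift
    ((LinearMap.mul k (Module.End k N)).compl₁₂ T.lact T.ract))
  have hp : p ∈ homs F.toBimodule T.toBimodule := by
    refine ⟨fun c => LinearMap.congr_fun (f := p ∘ₗ F.lact c) (g := T.lact c ∘ₗ p)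
      (TensorProduct.ext_threefold fun a b n => ?_),
      fun c => LinearMap.congr_fun (f := p ∘ₗ F.ract c) (g := T.ract c ∘ₗ p)
      (TensorProduct.ext_threefold fun a b n => ?_),
      fun _ => (map_zero (p.lTensor A)).symm, fun _ => (map_zero (p.rTensor A)).symm⟩
    · simp [p, F, tensorSpace, h₂]
    · simp [p, F, tensorSpace, h₄, h₅]
  have hs : Function.Surjective (sandwich A p) :=
    LinearMap.lTensor_surjective _ (LinearMap.rTensor_surjective _ fun n =>
      ⟨(1 ⊗ₜ 1) ⊗ₜ n, by simp [p, h₁, h₃]⟩)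
  obtain ⟨y, rfl⟩ := hs z
  have hF : ∀ y, F.cofree.LawfulAt y := boxTwo_lawful self_lawful
    (boxTwo_lawful (tensorSpace_lawful N (boxOne_lawful self_lawful self_lawful)) self_lawful)
  exact (hF y).map (sandwich_mem_cofree hp)

end Lawful

section Coinduced

variable (A) (V : Type u) [AddCommGroup V] [Module k V]

/-- The coinduced bimodule on a vector space `V`, with underlying space the bilinear maps
`A × A → V`. -/
def coinduced : TetraStr k A (A →ₗ[k] A →ₗ[k] V) where
  lact := LinearMap.mk₂ k (fun a w => w ∘ₗ LinearMap.mulRight k a)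
    (by intros; ext; simp [mul_add]) (by intros; ext; simp) (by intros; ext; simp)
    (by intros; ext; simp)
  ract := LinearMap.mk₂ k (fun a w => w.compl₂ (LinearMap.mulLeft k a))
    (by intros; ext; simp [add_mul]) (by intros; ext; simp) (by intros; ext; simp)
    (by intros; ext; simp)
  lcoact := 0
  rcoact := 0

variable {A V}

/-- The bimodule map to the coinduced bimodule corresponding to a linear map,
`m ↦ ((x, y) ↦ f (x * m * y))`. -/
def toCoinduced (S : TetraStr k A M) (f : M →ₗ[k] V) : M →ₗ[k] A →ₗ[k] A →ₗ[k] V where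
  toFun m := LinearMap.mk₂ k (fun x y => f (S.lact x (S.ract y m)))
    (by simp) (by simp) (by simp) (by simp)
  map_add' _ _ := by ext; simp
  map_smul' _ _ := by ext; simp

lemma toCoinduced_apply (S : TetraStr k A M) (f : M →ₗ[k] V) (m : M) (x y : A) :
    S.toCoinduced f m x y = f (S.lact x (S.ract y m)) := rfl

variable {S : TetraStr k A M} {T : TetraStr k A N}

lemma toCoinduced_mem (hS : ∀ m, S.LawfulAt m) (f : M →ₗ[k] V) :
    S.toCoinduced f ∈ homs S.toBimodule (coinduced A V).toBimodule := by
  refine ⟨fun a m => ?_, fun a m => ?_, fun _ => (map_zero ((S.toCoinduced f).lTensor A)).symm,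
    fun _ => (map_zero ((S.toCoinduced f).rTensor A)).symm⟩ <;> ext x y
  · simp [toBimodule, coinduced, toCoinduced_apply, (hS _).mul_lact, (hS _).lact_ract]
  · simp [toBimodule, coinduced, toCoinduced_apply, (hS _).mul_ract]

lemma toCoinduced_comp {i : M →ₗ[k] N} (hi : i ∈ homs S T) (f : N →ₗ[k] V) :
    T.toCoinduced f ∘ₗ i = S.toCoinduced (f ∘ₗ i) := by
  ext m x y
  simp [toCoinduced_apply, hi.1, hi.2.1]

/-- A bimodule map to a coinduced bimodule is determined by its value at `(1, 1)`. -/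
lemma toCoinduced_eval {g : M →ₗ[k] A →ₗ[k] A →ₗ[k] V}
    (hg : g ∈ homs S.toBimodule (coinduced A V).toBimodule) :
    S.toCoinduced (LinearMap.applyₗ (1 : A) ∘ₗ LinearMap.applyₗ (1 : A) ∘ₗ g) = g := by
  have h₁ : ∀ a m, g (S.lact a m) = (coinduced A V).lact a (g m) := hg.1
  have h₂ : ∀ a m, g (S.ract a m) = (coinduced A V).ract a (g m) := hg.2.1
  ext m x y
  simp [toCoinduced_apply, h₁, h₂, coinduced]

lemma cofree_coinduced_lawful (z) : (coinduced (k := k) A V).cofree.LawfulAt z := by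
  refine cofree_lawful ?_ ?_ ?_ ?_ ?_ z
  · intro w; ext; simp [coinduced]
  · intro a b w; ext; simp [coinduced, mul_assoc]
  · intro w; ext; simp [coinduced]
  · intro a b w; ext; simp [coinduced]
  · intro a b w; ext; simp [coinduced]

end Coinduced

end TetraStr

namespace Tetra

open TetraStr

variable {k : Type v} {A : Type u} [Field k] [Ring A] [Bialgebra k A]

variable (k A) in
/-- The cofree tetramodule on the coinduced bimodule of a vector space. -/
def cofreeCoinduced (V : Type u) [AddCommGroup V] [Module k V] : Tetra k A where
  carrier := A ⊗[k] ((A →ₗ[k] A →ₗ[k] V) ⊗[k] A)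
  str := (coinduced A V).cofree
  lawful := cofree_coinduced_lawful

/-- The morphism to a cofree coinduced tetramodule corresponding to a linear map. -/
def toCofreeCoinduced (M : Tetra k A) {V : Type u} [AddCommGroup V] [Module k V]
    (f : M.carrier →ₗ[k] V) : M ⟶ cofreeCoinduced k A V :=
  homMk (sandwich A (M.str.toCoinduced f) ∘ₗ M.str.bicoact)
    (comp_mem (bicoact_mem M.lawful) (sandwich_mem_cofree (toCoinduced_mem M.lawful f)))

/-- Morphisms to a cofree coinduced tetramodule correspond to linear maps to `V`, and these extend
along injections. -/
instance (V : Type u) [AddCommGroup V] [Module k V] : Injective (cofreeCoinduced k A V) where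
  factors {M N} g i _ := by
    let ev : (A →ₗ[k] A →ₗ[k] V) →ₗ[k] V := LinearMap.applyₗ (1 : A) ∘ₗ LinearMap.applyₗ (1 : A)
    let p := bicounit k A (A →ₗ[k] A →ₗ[k] V) ∘ₗ lin g
    obtain ⟨r, hr⟩ := LinearMap.exists_leftInverse_of_injective (lin i)
      (LinearMap.ker_eq_bot.2 (injective_of_mono i))
    refine ⟨toCofreeCoinduced N (ev ∘ₗ p ∘ₗ r), hom_ext ?_⟩
    have hp : p ∈ homs M.str.toBimodule (coinduced A V).toBimodule :=
      comp_mem (mem_toBimodule (lin_mem g)) (bicounit_mem _)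
    change (sandwich A (N.str.toCoinduced _) ∘ₗ N.str.bicoact) ∘ₗ lin i = lin g
    rw [LinearMap.comp_assoc, bicoact_comp (mem_toBicomodule (lin_mem i)), ← LinearMap.comp_assoc,
      ← sandwich_comp, toCoinduced_comp (lin_mem i), LinearMap.comp_assoc, LinearMap.comp_assoc,
      LinearMap.comp_assoc, hr, LinearMap.comp_id, toCoinduced_eval hp]
    exact sandwich_bicounit_comp (T := coinduced A V) (mem_toBicomodule (lin_mem g))

lemma mono_of_injective {M N : Tetra k A} (f : M ⟶ N) (hf : Function.Injective (lin f)) :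
    Mono f :=
  ⟨fun a b hab => by
    ext x
    exact hf (LinearMap.congr_fun (congrArg lin hab) x)⟩

/-- The morphism to the cofree coinduced tetramodule given by the identity of `M` is injective: the
counits and the evaluation at `(1, 1)` recover `m` from its image. -/
instance : EnoughInjectives (Tetra k A) where
  presentation M := ⟨{
    J := cofreeCoinduced k A M.carrier
    f := toCofreeCoinduced M LinearMap.id
    mono := mono_of_injective _ fun x y hxy => by
      have h : ∀ x, bicounit k A _ (lin (toCofreeCoinduced M LinearMap.id) x) 1 1 = x := by
        intro x
        change (bicounit k A _ ∘ₗ sandwich A (M.str.toCoinduced _)) (M.str.bicoact x) 1 1 = x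
        rw [← comp_bicounit, LinearMap.comp_apply, ← LinearMap.comp_apply _ M.str.bicoact,
          bicounit_bicoact M.lawful, LinearMap.id_apply, toCoinduced_apply, (M.lawful _).one_ract,
          (M.lawful _).one_lact]
        rfl
      rw [← h x, hxy, h] }⟩

end Tetra

end

/-! ### The bar and cobar resolutions -/

noncomputable section

namespace Tetra

open TetraStr

variable {k : Type v} {A : Type u} [Field k] [Ring A] [Bialgebra k A]
variable {M N P : Tetra k A}

/-- Exactness of tetramodules is exactness of the underlying vector spaces. -/
lemma exact_iff_ker_le_range (S : ShortComplex (Tetra k A)) :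
    S.Exact ↔ LinearMap.ker (lin S.g) ≤ LinearMap.range (lin S.f) := by
  rw [S.exact_iff_of_forks
    (isLimitOfExact (kerι S.g) S.g (kerι_comp S.g) (Submodule.injective_subtype _)
      (Submodule.range_subtype _).ge)
    (isColimitOfExact S.f (cokerπ S.f) (comp_cokerπ S.f) (Submodule.mkQ_surjective _)
      (Submodule.ker_mkQ _).le)]
  constructor
  · intro h x hx
    exact (Submodule.Quotient.mk_eq_zero _).1 (LinearMap.congr_fun (congrArg lin h) ⟨x, hx⟩)
  · intro h
    ext x
    exact (Submodule.Quotient.mk_eq_zero _).2 (h x.2)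

lemma lin_comp_eq_id {i : M ⟶ N} {p : N ⟶ M} (h : i ≫ p = 𝟙 M) : lin p ∘ₗ lin i = LinearMap.id :=
  congrArg lin h

lemma relInjective_of_retract (i : M ⟶ N) (p : N ⟶ M) (h : i ≫ p = 𝟙 M)
    (hN : N.str.RelInjective) : M.str.RelInjective := by
  obtain ⟨r, hr, hr'⟩ := hN
  refine ⟨lin p ∘ₗ r ∘ₗ sandwich A (lin i), comp_mem (comp_mem
    (sandwich_mem_cofree_toBicomodule _) hr) (mem_toBicomodule (lin_mem p)), ?_⟩
  rw [LinearMap.comp_assoc, LinearMap.comp_assoc, ← bicoact_comp (mem_toBicomodule (lin_mem i)),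
    ← LinearMap.comp_assoc (lin i), hr', LinearMap.id_comp, lin_comp_eq_id h]

lemma relProjective_of_retract (i : M ⟶ N) (p : N ⟶ M) (h : i ≫ p = 𝟙 M)
    (hN : N.str.RelProjective) : M.str.RelProjective := by
  obtain ⟨s, hs, hs'⟩ := hN
  refine ⟨sandwich A (lin p) ∘ₗ s ∘ₗ lin i, comp_mem (comp_mem (lin_mem i) hs)
    (sandwich_mem_free (mem_toBicomodule (lin_mem p))), ?_⟩
  rw [← LinearMap.comp_assoc, ← comp_biact (mem_toBimodule (lin_mem p)), LinearMap.comp_assoc,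
    ← LinearMap.comp_assoc (lin i), hs', LinearMap.id_comp, lin_comp_eq_id h]

lemma relInjective_of_isZero (h : IsZero M) : M.str.RelInjective :=
  ⟨0, Submodule.zero_mem _, congrArg lin (h.eq_of_src 0 (𝟙 M))⟩

lemma relProjective_of_isZero (h : IsZero M) : M.str.RelProjective :=
  ⟨0, Submodule.zero_mem _, congrArg lin (h.eq_of_src 0 (𝟙 M))⟩

/-- The retraction is `inl ∘ r ∘ (id ⊗ fst ⊗ id) + inr ∘ s ∘ (id ⊗ snd ⊗ id)`. -/
lemma relInjective_biprod (hM : M.str.RelInjective) (hN : N.str.RelInjective) :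
    (M ⊞ N).str.RelInjective := by
  obtain ⟨r, hr, hr'⟩ := hM
  obtain ⟨s, hs, hs'⟩ := hN
  refine ⟨lin biprod.inl ∘ₗ r ∘ₗ sandwich A (lin biprod.fst) +
    lin biprod.inr ∘ₗ s ∘ₗ sandwich A (lin biprod.snd), Submodule.add_mem _
      (comp_mem (comp_mem (sandwich_mem_cofree_toBicomodule _) hr) (mem_toBicomodule (lin_mem _)))
      (comp_mem (comp_mem (sandwich_mem_cofree_toBicomodule _) hs) (mem_toBicomodule (lin_mem _))),
      ?_⟩
  rw [LinearMap.add_comp, LinearMap.comp_assoc, LinearMap.comp_assoc, LinearMap.comp_assoc,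
    LinearMap.comp_assoc, ← bicoact_comp (mem_toBicomodule (lin_mem _)),
    ← bicoact_comp (mem_toBicomodule (lin_mem _)), ← LinearMap.comp_assoc (lin biprod.fst), hr',
    ← LinearMap.comp_assoc (lin biprod.snd), hs', LinearMap.id_comp, LinearMap.id_comp]
  exact congrArg lin (biprod.total (X := M) (Y := N))

/-- The two-sided coaction of an injective tetramodule is even split over tetramodules. -/
lemma relInjective_of_injective [Injective M] : M.str.RelInjective := by
  let i : M ⟶ (self k A).boxTwo (M.boxTwo (self k A)) := homMk M.str.bicoact (bicoact_mem M.lawful)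
  have : Mono i := mono_of_injective i (Function.LeftInverse.injective
    (g := bicounit k A M.carrier) (LinearMap.congr_fun (bicounit_bicoact M.lawful)))
  have h := lin_mem (Injective.factorThru (𝟙 M) i)
  exact ⟨lin (Injective.factorThru (𝟙 M) i), mem_toBicomodule (S := M.str.cofree) h,
    congrArg lin (Injective.comp_factorThru (𝟙 M) i)⟩

lemma rightRelInjective_cobarObj : ∀ n, (cobarObj k A n).str.RightRelInjective
  | 0 => rightRelInjective_self k A
  | n + 1 => (rightRelInjective_cobarObj n).boxTwo _

lemma relInjective_cobarObj (n : ℕ) : (cobarObj k A (n + 1)).str.RelInjective :=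
  (rightRelInjective_cobarObj n).relInjective

lemma rightRelProjective_barObj : ∀ n, (barObj k A n).str.RightRelProjective
  | 0 => rightRelProjective_self k A
  | n + 1 => (rightRelProjective_barObj n).boxOne _

lemma relProjective_barObj (n : ℕ) : (barObj k A (n + 1)).str.RelProjective :=
  (rightRelProjective_barObj n).relProjective

section Complex

lemma ker_le_range_of_acyclic {K : CochainComplex (Tetra k A) ℤ} (hK : K.Acyclic) (i j l : ℤ)
    (hij : i + 1 = j) (hjl : j + 1 = l) :
    LinearMap.ker (lin (K.d j l)) ≤ LinearMap.range (lin (K.d i j)) :=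
  (exact_iff_ker_le_range _).1
    ((K.exactAt_iff' i j l (by simp [← hij]) (by simp [← hjl])).1 (hK j))

/-- A bounded below acyclic complex of relatively injective tetramodules is contractible as a
complex of bicomodules. -/
lemma exists_splitting_of_acyclic (K : CochainComplex (Tetra k A) ℤ) (b : ℤ) [K.IsStrictlyGE b] (hK : K.Acyclic)
    (h : ∀ i, (K.X i).str.RelInjective) (i j : ℤ) (hij : i + 1 = j) :
    ∃ s ∈ homs (K.X j).str.toBicomodule (K.X i).str.toBicomodule,
      lin (K.d i j) ∘ₗ s ∘ₗ lin (K.d i j) = lin (K.d i j) := by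
  have key : ∀ (n : ℕ) (i j : ℤ), i + 1 = j → i < b + n →
      ∃ s ∈ homs (K.X j).str.toBicomodule (K.X i).str.toBicomodule,
        lin (K.d i j) ∘ₗ s ∘ₗ lin (K.d i j) = lin (K.d i j) := by
    intro n
    induction n with
    | zero =>
      intro i j _ hi
      refine ⟨0, Submodule.zero_mem _, ?_⟩
      rw [(K.isZero_of_isStrictlyGE b i (by lia)).eq_of_src (K.d i j) 0]
      rfl
    | succ n ih =>
      intro i j hij hi
      obtain ⟨s, hs, hs'⟩ := ih (i - 1) i (by lia) (by lia)
      exact (h i).exists_split (lin_mem _) (lin_mem _)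
        (ker_le_range_of_acyclic hK (i - 1) i j (by lia) hij)
        (congrArg lin (K.d_comp_d (i - 1) i j)) hs hs' (K.X j).lawful
  exact key (i - b + 1).toNat i j hij (by lia)

/-- The complex of morphisms from a bounded above complex of relatively projective tetramodules to
a bounded below acyclic complex of relatively injective tetramodules is acyclic. -/
lemma homAcyclic_of_relative (P K : CochainComplex (Tetra k A) ℤ) (a b : ℤ) [P.IsStrictlyLE a]
    [K.IsStrictlyGE b] (hP : ∀ i, (P.X i).str.RelProjective) (hK : K.Acyclic)
    (h : ∀ i, (K.X i).str.RelInjective) : HomAcyclic P K := by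
  refine homAcyclic_of_lift a b fun p i j l hij hjl g hg => ?_
  obtain ⟨s, hs, hs'⟩ := exists_splitting_of_acyclic K b hK h i j hij
  have hg' : LinearMap.range (lin g) ≤ LinearMap.range (lin (K.d i j)) := by
    refine le_trans ?_ (ker_le_range_of_acyclic hK i j l hij hjl)
    rintro _ ⟨x, rfl⟩
    exact LinearMap.congr_fun (congrArg lin hg) x
  obtain ⟨t, ht, ht'⟩ := (hP p).exists_lift (lin_mem _) hs hs' (lin_mem g) hg' (K.X i).lawful
  exact ⟨homMk t ht, hom_ext ht'⟩

lemma relInjective_mappingCone {K L : CochainComplex (Tetra k A) ℤ} (φ : K ⟶ L)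
    (hK : ∀ i, (K.X i).str.RelInjective) (hL : ∀ i, (L.X i).str.RelInjective) (i : ℤ) :
    ((CochainComplex.mappingCone φ).X i).str.RelInjective :=
  let e := HomologicalComplex.homotopyCofiber.XIsoBiprod φ i (i + 1) rfl
  relInjective_of_retract e.hom e.inv e.hom_inv_id (relInjective_biprod (hK _) (hL _))

lemma isStrictlyGE_mappingCone {K L : CochainComplex (Tetra k A) ℤ} (φ : K ⟶ L) (n : ℤ)
    (m : ℤ) (h : n + 1 = m)
    [K.IsStrictlyGE m] [L.IsStrictlyGE n] : (CochainComplex.mappingCone φ).IsStrictlyGE n := by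
  rw [CochainComplex.isStrictlyGE_iff]
  intro i hi
  exact IsZero.of_iso ((biprod_isZero_iff _ _).2 ⟨K.isZero_of_isStrictlyGE m _ (by lia),
    L.isZero_of_isStrictlyGE n _ hi⟩)
    (HomologicalComplex.homotopyCofiber.XIsoBiprod φ i (i + 1) rfl)

end Complex

section Resolution

variable (k A)

/-- The terms of the bar complex are relatively projective. -/
lemma relProjective_bar (i : ℤ) :
    (((bar k A).extend ComplexShape.embeddingDownNat).X i).str.RelProjective := by
  by_cases hi : i ≤ 0
  · obtain ⟨n, hn⟩ := Int.eq_ofNat_of_zero_le (a := -i) (by lia)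
    let e := (bar k A).extendXIso ComplexShape.embeddingDownNat (i := n) (i' := i)
      (by simp; lia)
    exact relProjective_of_retract e.hom e.inv e.hom_inv_id (relProjective_barObj n)
  · exact relProjective_of_isZero (CochainComplex.isZero_of_isStrictlyLE _ 0 _ (by lia))

/-- The terms of the cobar complex are relatively injective. -/
lemma relInjective_cobar (i : ℤ) :
    (((cobar k A).extend ComplexShape.embeddingUpNat).X i).str.RelInjective := by
  by_cases hi : 0 ≤ i
  · obtain ⟨n, hn⟩ := Int.eq_ofNat_of_zero_le hi
    let e := (cobar k A).extendXIso ComplexShape.embeddingUpNat (i := n) (i' := i)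
      (by simp; lia)
    exact relInjective_of_retract e.hom e.inv e.hom_inv_id (relInjective_cobarObj n)
  · exact relInjective_of_isZero (CochainComplex.isZero_of_isStrictlyGE _ 0 _ (by lia))

/-- The insertion `x ↦ 1 ⊗ x` of a unit, a contraction of the augmented bar complex. -/
def barContraction (n : ℕ) : (barObj k A n).carrier →ₗ[k] (barObj k A (n + 1)).carrier :=
  TensorProduct.mk k A (barObj k A n).carrier 1

lemma act_one_tmul (M : Tetra k A) (x : M.carrier) : lin (act M) ((1 : A) ⊗ₜ[k] x) = x :=
  (TensorProduct.lift.tmul _ _).trans (M.lawful x).one_lact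

lemma barD_zero_barContraction (x : (barObj k A 0).carrier) :
    lin (barD k A 0) (barContraction k A 0 x) = x :=
  act_one_tmul k A (self k A) x

lemma barD_succ_barContraction (n : ℕ) (x : (barObj k A (n + 1)).carrier) :
    lin (barD k A (n + 1)) (barContraction k A (n + 1) x) =
      x - barContraction k A n (lin (barD k A n) x) :=
  congrArg (· - barContraction k A n (lin (barD k A n) x)) (act_one_tmul k A (barObj k A (n + 1)) x)

lemma ker_barD_le (n : ℕ) :
    LinearMap.ker (lin (barD k A n)) ≤ LinearMap.range (lin (barD k A (n + 1))) := by
  intro x hx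
  refine ⟨barContraction k A (n + 1) x, ?_⟩
  rw [barD_succ_barContraction, LinearMap.mem_ker.1 hx, map_zero, sub_zero]

/-- The application of the counit to the left factor, a contraction of the augmented cobar
complex. -/
def cobarContraction (n : ℕ) : (cobarObj k A (n + 1)).carrier →ₗ[k] (cobarObj k A n).carrier :=
  counitLeft k A (cobarObj k A n).carrier

lemma counitLeft_coact (M : Tetra k A) (x : M.carrier) :
    counitLeft k A M.carrier (lin (coact M) x) = x :=
  (congrArg (TensorProduct.lid k M.carrier) (M.lawful x).lcoact_counit).trans (by simp)

lemma cobarContraction_cobarD_zero (x : (cobarObj k A 0).carrier) :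
    cobarContraction k A 0 (lin (cobarD k A 0) x) = x :=
  counitLeft_coact k A (self k A) x

lemma cobarContraction_cobarD_succ (n : ℕ) (x : (cobarObj k A (n + 1)).carrier) :
    cobarContraction k A (n + 1) (lin (cobarD k A (n + 1)) x) =
      x - lin (cobarD k A n) (cobarContraction k A n x) := by
  have h : counitLeft k A _ ∘ₗ (lin (cobarD k A n)).lTensor A =
      lin (cobarD k A n) ∘ₗ counitLeft k A _ :=
    TensorProduct.ext' fun a y => by simp [counitLeft_tmul]
  refine (map_sub (cobarContraction k A (n + 1)) _ _).trans ?_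
  exact congrArg₂ (· - ·) (counitLeft_coact k A (cobarObj k A (n + 1)) x) (LinearMap.congr_fun h x)

lemma ker_cobarD_succ_le (n : ℕ) :
    LinearMap.ker (lin (cobarD k A (n + 1))) ≤ LinearMap.range (lin (cobarD k A n)) := by
  intro x hx
  refine ⟨cobarContraction k A n x, ?_⟩
  have h := cobarContraction_cobarD_succ k A n x
  rw [LinearMap.mem_ker.1 hx, map_zero] at h
  exact (sub_eq_zero.1 h.symm).symm

lemma bar_d (n : ℕ) : (bar k A).d (n + 1) n = barD k A (n + 1) :=
  ChainComplex.of_d (fun n => barObj k A (n + 1)) (fun n => barD k A (n + 1)) n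

lemma cobar_d (n : ℕ) : (cobar k A).d n (n + 1) = cobarD k A (n + 1) :=
  CochainComplex.of_d (fun n => cobarObj k A (n + 1)) (fun n => cobarD k A (n + 1)) n

/-- The augmentation of the bar complex, the multiplication `A ⊠₁ A ⟶ A` in degree `0`. -/
def barAugmentation : bar k A ⟶ (ChainComplex.single₀ (Tetra k A)).obj (self k A) :=
  (ChainComplex.toSingle₀Equiv _ _).symm ⟨barD k A 0,
    (congrArg (· ≫ barD k A 0) (bar_d k A 0)).trans (barD_comp_barD k A 0)⟩

/-- The coaugmentation of the cobar complex, the comultiplication `A ⟶ A ⊠₂ A` in degree `0`. -/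
def cobarCoaugmentation : (CochainComplex.single₀ (Tetra k A)).obj (self k A) ⟶ cobar k A :=
  (CochainComplex.fromSingle₀Equiv _ _).symm ⟨cobarD k A 0,
    (congrArg (cobarD k A 0 ≫ ·) (cobar_d k A 0)).trans (cobarD_comp_cobarD k A 0)⟩

lemma barAugmentation_f_zero : (barAugmentation k A).f 0 = barD k A 0 :=
  ChainComplex.toSingle₀Equiv_symm_apply_f_zero _ _

lemma cobarCoaugmentation_f_zero : (cobarCoaugmentation k A).f 0 = cobarD k A 0 :=
  CochainComplex.fromSingle₀Equiv_symm_apply_f_zero _ _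

instance : QuasiIso (barAugmentation k A) where
  quasiIsoAt n := by
    cases n with
    | zero =>
      rw [ChainComplex.quasiIsoAt₀_iff, ShortComplex.quasiIso_iff_of_zeros' _ rfl rfl rfl]
      refine ⟨(exact_iff_ker_le_range _).2 ?_, ?_⟩
      · change LinearMap.ker (lin ((barAugmentation k A).f 0)) ≤
          LinearMap.range (lin ((bar k A).d 1 0))
        rw [barAugmentation_f_zero, bar_d]
        exact ker_barD_le k A 0
      · change Epi ((barAugmentation k A).f 0)
        rw [barAugmentation_f_zero]
        refine ⟨fun a b hab => ?_⟩
        ext x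
        rw [← barD_zero_barContraction k A x]
        exact LinearMap.congr_fun (congrArg lin hab) _
    | succ n =>
      rw [quasiIsoAt_iff_exactAt']
      · rw [HomologicalComplex.exactAt_iff' _ (n + 1 + 1) (n + 1) n (by simp) (by simp),
          exact_iff_ker_le_range]
        change LinearMap.ker (lin ((bar k A).d (n + 1) n)) ≤
          LinearMap.range (lin ((bar k A).d (n + 1 + 1) (n + 1)))
        rw [bar_d, bar_d]
        exact ker_barD_le k A (n + 1)
      · apply ChainComplex.exactAt_succ_single_obj

instance : QuasiIso (cobarCoaugmentation k A) where
  quasiIsoAt n := by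
    cases n with
    | zero =>
      rw [CochainComplex.quasiIsoAt₀_iff, ShortComplex.quasiIso_iff_of_zeros _ rfl rfl rfl]
      refine ⟨(exact_iff_ker_le_range _).2 ?_, ?_⟩
      · change LinearMap.ker (lin ((cobar k A).d 0 1)) ≤
          LinearMap.range (lin ((cobarCoaugmentation k A).f 0))
        rw [cobarCoaugmentation_f_zero, cobar_d]
        exact ker_cobarD_succ_le k A 0
      · change Mono ((cobarCoaugmentation k A).f 0)
        rw [cobarCoaugmentation_f_zero]
        exact mono_of_injective _ (Function.LeftInverse.injective
          (cobarContraction_cobarD_zero k A))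
    | succ n =>
      rw [quasiIsoAt_iff_exactAt]
      · rw [HomologicalComplex.exactAt_iff' _ n (n + 1) (n + 1 + 1) (by simp) (by simp),
          exact_iff_ker_le_range]
        change LinearMap.ker (lin ((cobar k A).d (n + 1) (n + 1 + 1))) ≤
          LinearMap.range (lin ((cobar k A).d n (n + 1)))
        rw [cobar_d, cobar_d]
        exact ker_cobarD_succ_le k A (n + 1)
      · apply CochainComplex.exactAt_succ_single_obj

/-- The quasi-isomorphism from the bar complex to `A`. -/
def barAugmentationInt : (bar k A).extend ComplexShape.embeddingDownNat ⟶
    (CochainComplex.singleFunctor (Tetra k A) 0).obj (self k A) :=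
  HomologicalComplex.extendMap (barAugmentation k A) ComplexShape.embeddingDownNat ≫
    (HomologicalComplex.extendSingleIso _ _ _ _ (by simp)).hom

instance : QuasiIso (barAugmentationInt k A) :=
  inferInstanceAs (QuasiIso (HomologicalComplex.extendMap (barAugmentation k A)
    ComplexShape.embeddingDownNat ≫ (HomologicalComplex.extendSingleIso
      ComplexShape.embeddingDownNat (self k A) 0 0 (by simp)).hom))

/-- The quasi-isomorphism from `A` to the cobar complex. -/
def cobarCoaugmentationInt : (CochainComplex.singleFunctor (Tetra k A) 0).obj (self k A) ⟶
    (cobar k A).extend ComplexShape.embeddingUpNat :=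
  (HomologicalComplex.extendSingleIso _ _ _ _ (by simp)).inv ≫
    HomologicalComplex.extendMap (cobarCoaugmentation k A) ComplexShape.embeddingUpNat

instance : QuasiIso (cobarCoaugmentationInt k A) :=
  inferInstanceAs (QuasiIso ((HomologicalComplex.extendSingleIso
    ComplexShape.embeddingUpNat (self k A) 0 0 (by simp)).inv ≫
      HomologicalComplex.extendMap (cobarCoaugmentation k A) ComplexShape.embeddingUpNat))

end Resolution

end Tetra

end

/-- For every bialgebra `A` over a field `k` (not necessarily a Hopf algebra), the groups
`Ext(A, A)` in the abelian category of tetramodules over `A` are the Gerstenhaber-Schack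
cohomology spaces of `A`, as vector spaces over `k`. -/
theorem theorem3p1 (k : Type v) (A : Type u) [Field k] [Ring A] [Bialgebra k A] (n : ℕ) :
    Nonempty (Abelian.Ext (Tetra.self k A) (Tetra.self k A) n ≃ₗ[k] gsCohomology k A n) := by
  refine nonempty_ext_linearEquiv_homology k n (Tetra.barAugmentationInt k A)
    (Tetra.cobarCoaugmentationInt k A) fun I φ hI hI' hφ => ?_
  have : CochainComplex.IsStrictlyGE I (-1) := I.isStrictlyGE_of_ge (-1) 0 (by lia)
  have := Tetra.isStrictlyGE_mappingCone φ (-1) 0 rfl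
  exact Tetra.homAcyclic_of_relative _ _ 0 (-1) (Tetra.relProjective_bar k A)
    (acyclic_mappingCone φ) (Tetra.relInjective_mappingCone φ (Tetra.relInjective_cobar k A)
      fun i => have := hI' i; Tetra.relInjective_of_injective)
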